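/- For each $n\ge 1$ let $\{(a_{j,n},b_{j,n});\,j\in\mathbb Z\}$ be independent pairs of complex random variables, $a_{j,n}=x_{j,n}+\mathrm i y_{j,n}$, $b_{j,n}=x'_{j,n}+\mathrm i y'_{j,n}$, with $\mathbf E a_{j,n}=\mathbf E b_{j,n}=0$ and $\mathbf E|a_{j,n}|^2=\mathbf E|b_{j,n}|^2=1$. Suppose that the second moments $$\mathbf E[x_{j,n}^2],\ \mathbf E[y_{j,n}^2],\ \mathbf E[x_{j,n}'^2],\ \mathbf E[y_{j,n}'^2]$$ and the mixed moments $$\mathbf E[x_{j,n}y_{j,n}]=\rho_1,\ \mathbf E[x_{j,n}x'_{j,n}]=\rho_2,\ \mathbf E[x_{j,n}y'_{j,n}]=\rho_3,\ \mathbf E[x'_{j,n}y_{j,n}]=\rho_4,\ \mathbf E[x'_{j,n}y'_{j,n}]=\rho_5,\ \mathbf E[y_{j,n}y'_{j,n}]=\rho_6$$ do not depend on $j$ and $n$, and that for every $k\ge1$ the numbers $\mathbf E|x_{j,n}|^k,\mathbf E|y_{j,n}|^k,\mathbf E|x'_{j,n}|^k,\mathbf E|y'_{j,n}|^k$ are bounded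 by a constant $c_k<\infty$ independent of $j$ and $n$. For sequences $s,t$ indexed by $\mathbb Z$, the $n\times n$ generalized Toeplitz matrix with inputs $s,t$ has $(i,j)$ entry $s_{i-j}$ if $i+j\le n$ and $t_{i-j}$ if $i+j\ge n+1$ ($1\le i,j\le n$). Let $T_{n,g}$ be the one with inputs $(a_{j,n})_j,(b_{j,n})_j$, and for $1\le i\le m$ let $D^{(i)}_{n,g}$ be the one with deterministic complex inputs $d'^{(i)},d''^{(i)}$ (not depending on $n$) such that $\sum_{k\in\mathbb Z}|d'^{(i)}_k|<\infty$ and $\sum_{k\in\mathbb Z}|d''^{(i)}_k|<\infty$. Let $P_n$ be the $n\times n$ backward identity permutation matrix, with $(i,j)$ entry $1$ if $i+j=n+1$ and $0$ otherwise. Matrices $A_{1,n},\dots,A_{p,n}$ (random, $n\times n$, entries with all moments finite) are said to converge jointly in $*$-distribution if there are a unital $*$-algebra $\mathcal A$ over $\mathbb C$, a linear functional $\varphi$ on $\mathcal A$ with $\varphi(1)=1$ and $\varphi(aa^*)\ge0$ for all $a\in\mathcal A$, and $a_1,\dots,a_p\in\mathcal A$ such that $$\lim_{n\to\infty}\frac1n\mathbf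 E\,\mathrm{Tr}\bigl(A_{i_1,n}^{\epsilon_1}\cdots A_{i_k,n}^{\epsilon_k}\bigr)=\varphi\bigl(a_{i_1}^{\epsilon_1}\cdots a_{i_k}^{\epsilon_k}\bigr)$$ for all $k\ge1$, $i_1,\dots,i_k\in\{1,\dots,p\}$ and $\epsilon_1,\dots,\epsilon_k\in\{1,*\}$. (1) If, for each $n$, $B_n^{(1)},\dots,B_n^{(m)}$ are independent copies of $n^{-1/2}T_{n,g}$, then $\{P_n,\,B_n^{(i)},\,D_{n,g}^{(i)};\ 1\le i\le m\}$ converge jointly in $*$-distribution. (2) In particular, $\{P_n,\,n^{-1/2}T_{n,g},\,D_{n,g}\}$ converge jointly in $*$-distribution, for every deterministic generalized Toeplitz matrix $D_{n,g}$ with absolutely summable inputs. (3) Let $H_n$ be the asymmetric Hankel matrix whose $(i,j)$ entry is $a_{n+1-i-j,n}$ if $i>j$ and $b_{n+1-i-j,n}$ if $i\le j$. Then $H_n=P_nT_{n,g}$, and if, for each $n$, $C_n^{(1)},\dots,C_n^{(m)}$ are independent copies of $n^{-1/2}H_n$, then $\{P_n,\,C_n^{(i)},\,D_{n,g}^{(i)};\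 1\le i\le m\}$ converge jointly in $*$-distribution. -/

import Mathlib

open MeasureTheory ProbabilityTheory Filter Topology

/-! ### `*`-probability spaces and joint convergence in `*`-distribution -/

section StarProbability

open scoped ComplexOrder

/-- The functional `φ` of a `*`-probability space `(A, φ)`: linear, `φ 1 = 1`, and
`φ (a a*) ≥ 0` for every `a` (with the order of `ℂ`, so `φ (a a*)` is real and nonnegative). -/
structure StarState (A : Type*) [Ring A] [StarRing A] [Algebra ℂ A] where
  toLin : A →ₗ[ℂ] ℂ
  map_one : toLin 1 = 1
  nonneg : ∀ a : A, 0 ≤ toLin (a * star a)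

end StarProbability

/-- The monomial `x_{i₁}^{ε₁} ⋯ x_{i_k}^{ε_k}` of the word `[(i₁, ε₁), …, (i_k, ε_k)]`; the letter
`(i, false)` stands for `x_i` and `(i, true)` for `x_i^*`. -/
def starMonomial {ι A : Type*} [Monoid A] [Star A] (x : ι → A) (w : List (ι × Bool)) : A :=
  (w.map fun l => if l.2 then star (x l.1) else x l.1).prod

/-- The state `φ_n(M) = n⁻¹ E[Tr M]` on random `n × n` matrices. -/
noncomputable def traceState {Ω : Type*} [MeasurableSpace Ω] (μ : Measure Ω) {n : ℕ}
    (M : Ω → Matrix (Fin n) (Fin n) ℂ) : ℂ :=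
  (n : ℂ)⁻¹ * ∫ ω, (M ω).trace ∂μ

/-- The sequences of random matrices `M i n` (of size `n × n`, on the probability space
`(Ω n, μ n)`) have entries with all moments finite, and they converge jointly in
`*`-distribution to the elements `x i` of the `*`-probability space `(A, φ)`. -/
def ConvergesInStarDistribution {ι : Type*} {Ω : ℕ → Type*} [∀ n, MeasurableSpace (Ω n)]
    (μ : ∀ n, Measure (Ω n)) (M : ι → ∀ n, Ω n → Matrix (Fin n) (Fin n) ℂ)
    {A : Type*} [Ring A] [StarRing A] [Algebra ℂ A] (φ : StarState A) (x : ι → A) : Prop :=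
  (∀ (i : ι) (n : ℕ) (r s : Fin n) (k : ℕ), MemLp (fun ω => M i n ω r s) k (μ n)) ∧
  ∀ w : List (ι × Bool), w ≠ [] →
    Tendsto (fun n => traceState (μ n) fun ω => starMonomial (fun i => M i n ω) w) atTop
      (𝓝 (φ.toLin (starMonomial x w)))

/-- The sequences of random matrices `M i n` converge jointly in `*`-distribution to some elements
of some `*`-probability space. -/
def ConvergeJointly {ι : Type*} {Ω : ℕ → Type*} [∀ n, MeasurableSpace (Ω n)]
    (μ : ∀ n, Measure (Ω n)) (M : ι → ∀ n, Ω n → Matrix (Fin n) (Fin n) ℂ) : Prop :=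
  ∃ (A : Type) (_ : Ring A) (_ : StarRing A) (_ : Algebra ℂ A) (_ : StarModule ℂ A)
    (φ : StarState A) (x : ι → A), ConvergesInStarDistribution μ M φ x

/-! ### The matrices -/

/-- The backward identity permutation matrix `P_n`. -/
def backwardIdentity (n : ℕ) : Matrix (Fin n) (Fin n) ℂ :=
  Matrix.of fun i j => if j = i.rev then 1 else 0

/-- The generalized Toeplitz matrix: with rows and columns numbered `1, …, n`, the `(i, j)` entry is
`a_{i-j}` if `i + j ≤ n` and `b_{i-j}` if `i + j ≥ n + 1`. (`Fin n` is numbered from `0`.) -/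
def genToeplitz (n : ℕ) (a b : ℤ → ℂ) : Matrix (Fin n) (Fin n) ℂ :=
  Matrix.of fun i j =>
    if (i.val + 1) + (j.val + 1) ≤ n then a ((i.val : ℤ) - (j.val : ℤ))
    else b ((i.val : ℤ) - (j.val : ℤ))

/-- The asymmetric Hankel matrix: with rows and columns numbered `1, …, n`, the `(i, j)` entry is
`a_{n+1-i-j}` below the diagonal (`j < i`) and `b_{n+1-i-j}` on and above it. -/
def asymHankel (n : ℕ) (a b : ℤ → ℂ) : Matrix (Fin n) (Fin n) ℂ :=
  Matrix.of fun i j =>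
    if j < i then a ((n : ℤ) + 1 - ((i.val : ℤ) + 1) - ((j.val : ℤ) + 1))
    else b ((n : ℤ) + 1 - ((i.val : ℤ) + 1) - ((j.val : ℤ) + 1))

/-- The random matrix `n^{-1/2} T_{n,g}` with random inputs `a`, `b`. -/
noncomputable def scaledToeplitz {Ω : Type*} (n : ℕ) (a b : ℤ → Ω → ℂ) (ω : Ω) :
    Matrix (Fin n) (Fin n) ℂ :=
  (((Real.sqrt n)⁻¹ : ℝ) : ℂ) • genToeplitz n (fun j => a j ω) (fun j => b j ω)

/-- The random matrix `n^{-1/2} H_n` with random inputs `a`, `b`. -/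
noncomputable def scaledHankel {Ω : Type*} (n : ℕ) (a b : ℤ → Ω → ℂ) (ω : Ω) :
    Matrix (Fin n) (Fin n) ℂ :=
  (((Real.sqrt n)⁻¹ : ℝ) : ℂ) • asymHankel n (fun j => a j ω) (fun j => b j ω)

/-! ### Random inputs and independent copies -/

/-- The assumption on the pair `a = x + i y`, `b = x' + i y'` of random input sequences (for a fixed
size `n`): the pairs `(a_j, b_j)`, `j ∈ ℤ`, are independent; `a_j`, `b_j` have mean zero and variance
one; the second moments of `x_j, y_j, x'_j, y'_j` are `v 0, …, v 3` and their mixed moments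
`ρ 0, …, ρ 5` for every `j`; and the absolute moments of order `k` are at most `c k`. -/
structure InputAssumption {Ω : Type*} [MeasurableSpace Ω] (μ : Measure Ω)
    (v : Fin 4 → ℝ) (ρ : Fin 6 → ℝ) (c : ℕ → ℝ) (a b : ℤ → Ω → ℂ) : Prop where
  measurable_a : ∀ j, Measurable (a j)
  measurable_b : ∀ j, Measurable (b j)
  indep : iIndepFun (fun j ω => (a j ω, b j ω)) μ
  mean_a : ∀ j, ∫ ω, a j ω ∂μ = 0
  mean_b : ∀ j, ∫ ω, b j ω ∂μ = 0
  variance_a : ∀ j, ∫ ω, ‖a j ω‖ ^ 2 ∂μ = 1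
  variance_b : ∀ j, ∫ ω, ‖b j ω‖ ^ 2 ∂μ = 1
  sq_x : ∀ j, ∫ ω, (a j ω).re ^ 2 ∂μ = v 0
  sq_y : ∀ j, ∫ ω, (a j ω).im ^ 2 ∂μ = v 1
  sq_x' : ∀ j, ∫ ω, (b j ω).re ^ 2 ∂μ = v 2
  sq_y' : ∀ j, ∫ ω, (b j ω).im ^ 2 ∂μ = v 3
  corr_x_y : ∀ j, ∫ ω, (a j ω).re * (a j ω).im ∂μ = ρ 0
  corr_x_x' : ∀ j, ∫ ω, (a j ω).re * (b j ω).re ∂μ = ρ 1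
  corr_x_y' : ∀ j, ∫ ω, (a j ω).re * (b j ω).im ∂μ = ρ 2
  corr_x'_y : ∀ j, ∫ ω, (b j ω).re * (a j ω).im ∂μ = ρ 3
  corr_x'_y' : ∀ j, ∫ ω, (b j ω).re * (b j ω).im ∂μ = ρ 4
  corr_y_y' : ∀ j, ∫ ω, (a j ω).im * (b j ω).im ∂μ = ρ 5
  moment_x : ∀ j, ∀ k ≥ 1, Integrable (fun ω => |(a j ω).re| ^ k) μ ∧
    ∫ ω, |(a j ω).re| ^ k ∂μ ≤ c k
  moment_y : ∀ j, ∀ k ≥ 1, Integrable (fun ω => |(a j ω).im| ^ k) μ ∧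
    ∫ ω, |(a j ω).im| ^ k ∂μ ≤ c k
  moment_x' : ∀ j, ∀ k ≥ 1, Integrable (fun ω => |(b j ω).re| ^ k) μ ∧
    ∫ ω, |(b j ω).re| ^ k ∂μ ≤ c k
  moment_y' : ∀ j, ∀ k ≥ 1, Integrable (fun ω => |(b j ω).im| ^ k) μ ∧
    ∫ ω, |(b j ω).im| ^ k ∂μ ≤ c k

/-- The random matrices `C i` on `(Ω, μ)` are independent copies of the random matrix `M` on
`(Ω₀, μ₀)`: each has the law of `M`, and they are independent. Laws and independence are those of
the arrays of entries. -/
structure IsIndepCopies {ι Ω Ω₀ : Type*} [MeasurableSpace Ω] [MeasurableSpace Ω₀]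
    (μ : Measure Ω) (μ₀ : Measure Ω₀) {n : ℕ}
    (C : ι → Ω → Matrix (Fin n) (Fin n) ℂ) (M : Ω₀ → Matrix (Fin n) (Fin n) ℂ) : Prop where
  ident : ∀ i, IdentDistrib (fun ω (r s : Fin n) => C i ω r s) (fun ω (r s : Fin n) => M ω r s) μ μ₀
  indep : iIndepFun (fun i ω (r s : Fin n) => C i ω r s) μ

/-! ### The families of matrices -/

/-- Labels of the matrices `P_n`, `B_{n,1}^{(i)}` (random) and `B_{n,2}^{(i)}` (deterministic). -/
inductive MatrixLabel (m : ℕ) : Type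
  | perm : MatrixLabel m
  | rand (i : Fin m) : MatrixLabel m
  | det (i : Fin m) : MatrixLabel m

/-- The family consisting of `P_n`, of random matrices `R i n` and of the deterministic generalized
Toeplitz matrices with input sequences `d' i`, `d'' i`. -/
def matrixFamily {m : ℕ} {Ω : ℕ → Type*} (R : Fin m → ∀ n, Ω n → Matrix (Fin n) (Fin n) ℂ)
    (d' d'' : Fin m → ℤ → ℂ) : MatrixLabel m → ∀ n, Ω n → Matrix (Fin n) (Fin n) ℂ
  | .perm, n, _ => backwardIdentity n
  | .rand i, n, ω => R i n ω
  | .det i, n, _ => genToeplitz n (d' i) (d'' i)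

/-! The proof is the method of moments. It suffices that every mixed `*`-moment converges: the
limits then define a linear functional on the free `*`-algebra, and it is positive because each `n⁻¹
E Tr (M M*)` is nonnegative (`convergeJointly_of_forall_tendsto`).

Expand the trace of a word of length `L` over closed paths of matrix indices. A path is determined
by its starting point and by the input indices read off at its `L` steps. An entry of a generalized
Toeplitz matrix depends on the input index and on the side of the antidiagonal only, and `P_n` acts
as a deterministic letter with input `δ₀` at `n - 1 - p - q`. Hence a term is a summable
deterministic weight times an expectation of a product of random inputs.

Group the terms by the partition that records which random positions share a copy and an index. By
independence and centering, a random position alone in its block makes the expectation vanish. So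
`r` random positions form `b ≤ r / 2` blocks. The starting point and the `b` block indices range
over `O(n)` values each, the deterministic indices are summed against summable weights, and the
normalization is `n^(-1 - r/2)`. If `2 b < r` the contribution vanishes in the limit. If `2 b = r`
the partition pairs the random positions, and the expectation is a product of second moments, which
depends on the sides alone.

For a pairing, the normalized sum is the integral of a step function, with `⌊n x⌋` in the scaling
coordinates and `⌊x⌋` in the others (`exists_tendsto_sum_latticeBox`). Validity and closure of the
path, the sides and the coincidences of inputs are all conditions on integer affine functions of the
coordinates and `n`. For almost every `x` each of them is eventually true or eventually false
(`ae_eventuallyDecided_affine`), so the integrand converges and dominated convergence applies. The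
value of the limit is never needed.

The Hankel case follows from `H_n = P_n T_{n,g}` and `P_n² = 1`: if the `C` are copies of the Hankel
matrix, then the `P_n C` are copies of the Toeplitz matrix, and `C = P_n (P_n C)` is a monomial in a
convergent family. -/

/-! ### Random variables with all moments finite -/

/-- All moments of `f` are finite. -/
def HasAllMoments {Ω : Type*} [MeasurableSpace Ω] (μ : Measure Ω) (f : Ω → ℂ) : Prop :=
  ∀ k : ℕ, MemLp f k μ

namespace HasAllMoments

variable {Ω : Type*} [MeasurableSpace Ω] {μ : Measure Ω} {f g : Ω → ℂ}

theorem const [IsFiniteMeasure μ] (c : ℂ) : HasAllMoments μ fun _ => c := fun _ => memLp_const c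

theorem add (hf : HasAllMoments μ f) (hg : HasAllMoments μ g) :
    HasAllMoments μ fun ω => f ω + g ω := fun k => (hf k).add (hg k)

theorem mul (hf : HasAllMoments μ f) (hg : HasAllMoments μ g) :
    HasAllMoments μ fun ω => f ω * g ω := by
  intro k
  have : ENNReal.HolderTriple ((2 * k : ℕ) : ENNReal) ((2 * k : ℕ) : ENNReal) (k : ENNReal) := by
    constructor
    rcases Nat.eq_zero_or_pos k with rfl | hk
    · simp
    · push_cast
      rw [ENNReal.mul_inv (by simp) (by simp), ← add_mul, ENNReal.inv_two_add_inv_two, one_mul]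
  exact (hg (2 * k)).mul (hf (2 * k))

theorem star (hf : HasAllMoments μ f) : HasAllMoments μ fun ω => star (f ω) :=
  fun k => (hf k).star

theorem sum {κ : Type*} [IsFiniteMeasure μ] (s : Finset κ) {F : κ → Ω → ℂ}
    (hF : ∀ i ∈ s, HasAllMoments μ (F i)) : HasAllMoments μ fun ω => ∑ i ∈ s, F i ω :=
  fun k => memLp_finsetSum s fun i hi => hF i hi k

theorem prod {κ : Type*} [IsFiniteMeasure μ] (s : Finset κ) {F : κ → Ω → ℂ}
    (hF : ∀ i ∈ s, HasAllMoments μ (F i)) : HasAllMoments μ fun ω => ∏ i ∈ s, F i ω := by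
  classical
  induction s using Finset.induction_on with
  | empty => simpa using const (μ := μ) 1
  | insert i s hi ih =>
    simp only [Finset.prod_insert hi]
    exact (hF i (by simp)).mul (ih fun j hj => hF j (by simp [hj]))

theorem integrable (hf : HasAllMoments μ f) : Integrable f μ :=
  memLp_one_iff_integrable.1 (by simpa using hf 1)

end HasAllMoments

theorem hasAllMoments_starMonomial {ι Ω : Type*} [MeasurableSpace Ω] {μ : Measure Ω}
    [IsFiniteMeasure μ] {n : ℕ} {M : ι → Ω → Matrix (Fin n) (Fin n) ℂ}
    (hM : ∀ i r s, HasAllMoments μ fun ω => M i ω r s) (w : List (ι × Bool)) (r s : Fin n) :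
    HasAllMoments μ fun ω => starMonomial (fun i => M i ω) w r s := by
  induction w generalizing r with
  | nil =>
    simp only [starMonomial, List.map_nil, List.prod_nil]
    exact .const _
  | cons l w ih =>
    have : (fun ω => starMonomial (fun i => M i ω) (l :: w) r s) = fun ω => ∑ t,
        (if l.2 then star (M l.1 ω t r) else M l.1 ω r t) *
          starMonomial (fun i => M i ω) w t s := by
      funext ω
      simp only [starMonomial, List.map_cons, List.prod_cons, Matrix.mul_apply]
      refine Finset.sum_congr rfl fun t _ => ?_
      split <;> simp
    rw [this]
    refine .sum _ fun t _ => .mul ?_ (ih t)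
    split
    · exact (hM _ _ _).star
    · exact hM _ _ _

/-! ### The free `*`-algebra -/

/-- The adjoint of a word: reverse it and exchange `x` and `x*`. -/
def adjointWord {ι : Type*} (w : FreeMonoid (ι × Bool)) : FreeMonoid (ι × Bool) :=
  FreeMonoid.ofList ((w.toList.map fun l => (l.1, !l.2)).reverse)

theorem adjointWord_adjointWord {ι : Type*} (w : FreeMonoid (ι × Bool)) :
    adjointWord (adjointWord w) = w := by
  simp [adjointWord, List.map_reverse, Function.comp_def]

theorem adjointWord_mul {ι : Type*} (w z : FreeMonoid (ι × Bool)) :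
    adjointWord (w * z) = adjointWord z * adjointWord w := by
  simp [adjointWord, FreeMonoid.toList_mul]

/-- The free `*`-algebra over `ℂ` on the generators `ι`. -/
abbrev FreeStarAlgebra (ι : Type*) := MonoidAlgebra ℂ (FreeMonoid (ι × Bool))

namespace FreeStarAlgebra

variable {ι : Type*}

/-- The involution of the free `*`-algebra as an additive map. -/
noncomputable def adjointHom (ι : Type*) : FreeStarAlgebra ι →+ FreeStarAlgebra ι :=
  (Finsupp.liftAddHom fun w => (MonoidAlgebra.singleAddHom (adjointWord w)).comp
    (starAddEquiv : ℂ ≃+ ℂ).toAddMonoidHom).comp MonoidAlgebra.coeffAddEquiv.toAddMonoidHom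

theorem adjointHom_single (w : FreeMonoid (ι × Bool)) (c : ℂ) :
    adjointHom ι (MonoidAlgebra.single w c) = MonoidAlgebra.single (adjointWord w) (star c) := by
  change (Finsupp.single w c).sum (fun v r => MonoidAlgebra.single (adjointWord v) (star r)) = _
  rw [Finsupp.sum_single_index (by simp)]

theorem adjointHom_adjointHom (f : FreeStarAlgebra ι) : adjointHom ι (adjointHom ι f) = f := by
  induction f using MonoidAlgebra.induction_linear with
  | zero => simp
  | add x y hx hy => rw [map_add, map_add, hx, hy]
  | single w c => rw [adjointHom_single, adjointHom_single, adjointWord_adjointWord, star_star]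

theorem adjointHom_mul (f g : FreeStarAlgebra ι) :
    adjointHom ι (f * g) = adjointHom ι g * adjointHom ι f := by
  induction f using MonoidAlgebra.induction_linear with
  | zero => simp
  | add x y hx hy => rw [add_mul, map_add, map_add, mul_add, hx, hy]
  | single w c =>
    induction g using MonoidAlgebra.induction_linear with
    | zero => simp
    | add x y hx hy => rw [mul_add, map_add, map_add, add_mul, hx, hy]
    | single z d =>
      simp only [MonoidAlgebra.single_mul_single, adjointHom_single, adjointWord_mul, star_mul]

noncomputable instance : StarRing (FreeStarAlgebra ι) where
  star := adjointHom ι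
  star_involutive := adjointHom_adjointHom
  star_mul := adjointHom_mul
  star_add := map_add _

theorem star_single (w : FreeMonoid (ι × Bool)) (c : ℂ) :
    star (MonoidAlgebra.single w c : FreeStarAlgebra ι) =
      MonoidAlgebra.single (adjointWord w) (star c) := adjointHom_single w c

instance : StarModule ℂ (FreeStarAlgebra ι) where
  star_smul c f := by
    induction f using MonoidAlgebra.induction_linear with
    | zero => simp
    | add x y hx hy => rw [smul_add, star_add, star_add, smul_add, hx, hy]
    | single w d => simp [star_single]

/-- The generators of the free `*`-algebra. -/
noncomputable def gen (i : ι) : FreeStarAlgebra ι :=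
  MonoidAlgebra.single (FreeMonoid.of (i, false)) 1

theorem starMonomial_gen (w : List (ι × Bool)) :
    starMonomial (gen (ι := ι)) w = MonoidAlgebra.single (FreeMonoid.ofList w) 1 := by
  induction w with
  | nil => rfl
  | cons l w ih =>
    rw [starMonomial] at ih ⊢
    rw [List.map_cons, List.prod_cons, ih]
    obtain ⟨i, _ | _⟩ := l
    · simp only [gen, Bool.false_eq_true, if_false, MonoidAlgebra.single_mul_single, one_mul]
      rfl
    · simp only [gen, if_true, star_single, MonoidAlgebra.single_mul_single, star_one, one_mul]
      rfl

/-- Evaluation of the elements of the free `*`-algebra. -/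
noncomputable def eval {A : Type*} [Ring A] [StarRing A] [Algebra ℂ A] (x : ι → A) :
    FreeStarAlgebra ι →ₐ[ℂ] A :=
  MonoidAlgebra.lift ℂ A _ (FreeMonoid.lift fun l => if l.2 then star (x l.1) else x l.1)

theorem eval_single {A : Type*} [Ring A] [StarRing A] [Algebra ℂ A] (x : ι → A)
    (w : FreeMonoid (ι × Bool)) (c : ℂ) :
    eval x (MonoidAlgebra.single w c) = c • starMonomial x w.toList := by
  simp [eval, MonoidAlgebra.lift_single, FreeMonoid.lift_apply, starMonomial]

theorem star_starMonomial {A : Type*} [Ring A] [StarRing A] (x : ι → A)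
    (w : FreeMonoid (ι × Bool)) :
    star (starMonomial x w.toList) = starMonomial x (adjointWord w).toList := by
  have key : ∀ v : List (ι × Bool), star (starMonomial x v) =
      starMonomial x ((v.map fun l => (l.1, !l.2)).reverse) := by
    intro v
    induction v with
    | nil => simp [starMonomial]
    | cons l v ih =>
      simp only [starMonomial] at ih ⊢
      simp only [List.map_cons, List.prod_cons, star_mul, ih, List.reverse_cons, List.map_append,
        List.prod_append, List.map_nil, List.prod_nil, mul_one]
      congr 1
      cases l.2 <;> simp
  exact key _

/-- This turns the evaluation of `f * star f` into a product `M * star M`, whose trace is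
nonnegative. -/
theorem eval_star {A : Type*} [Ring A] [StarRing A] [Algebra ℂ A] [StarModule ℂ A] (x : ι → A)
    (f : FreeStarAlgebra ι) : eval x (star f) = star (eval x f) := by
  induction f using MonoidAlgebra.induction_linear with
  | zero => simp
  | add f g hf hg => rw [star_add, map_add, map_add, star_add, hf, hg]
  | single w c => rw [star_single, eval_single, eval_single, star_smul, star_starMonomial]

end FreeStarAlgebra

/-! ### A criterion for joint convergence -/

section Criterion

open scoped ComplexOrder

/-- The trace of `M M*` is the sum of the squared moduli of the entries. No integrability is needed,
since the integral of a nonnegative function is nonnegative in any case. -/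
theorem traceState_mul_star_nonneg {Ω : Type*} [MeasurableSpace Ω] (μ : Measure Ω) {n : ℕ}
    (M : Ω → Matrix (Fin n) (Fin n) ℂ) : 0 ≤ traceState μ fun ω => M ω * star (M ω) := by
  refine mul_nonneg (by rw [← Complex.ofReal_natCast, ← Complex.ofReal_inv]; positivity) ?_
  have h : ∀ ω, (M ω * star (M ω)).trace = ((∑ i, ∑ j, ‖M ω i j‖ ^ 2 : ℝ) : ℂ) := by
    intro ω
    simp only [Matrix.trace, Matrix.diag, Matrix.mul_apply, Matrix.star_apply]
    push_cast
    simp [← Complex.mul_conj']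
  simp only [h]
  rw [integral_complex_ofReal, Complex.zero_le_real]
  exact integral_nonneg fun ω => by positivity

/-- Matrices whose entries have all moments converge jointly in `*`-distribution as soon as all
their mixed `*`-moments converge. -/
theorem convergeJointly_of_forall_tendsto {ι : Type} {Ω : ℕ → Type*} [∀ n, MeasurableSpace (Ω n)]
    (μ : ∀ n, Measure (Ω n)) [∀ n, IsProbabilityMeasure (μ n)]
    (M : ι → ∀ n, Ω n → Matrix (Fin n) (Fin n) ℂ)
    (hM : ∀ i n r s, HasAllMoments (μ n) fun ω => M i n ω r s)
    (hlim : ∀ w : List (ι × Bool), w ≠ [] → ∃ c : ℂ, Tendsto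
      (fun n => traceState (μ n) fun ω => starMonomial (fun i => M i n ω) w) atTop (𝓝 c)) :
    ConvergeJointly μ M := by
  have hnil : Tendsto (fun n => traceState (μ n) fun ω =>
      starMonomial (fun i => M i n ω) ([] : List (ι × Bool))) atTop (𝓝 1) := by
    -- For `n = 0` the normalized trace of the identity is `0`, not `1`.
    refine tendsto_const_nhds.congr' ?_
    filter_upwards [eventually_ge_atTop 1] with n hn
    have : (n : ℂ) ≠ 0 := by exact_mod_cast (by omega : n ≠ 0)
    simp [traceState, starMonomial, this]
  have hlim' : ∀ w : List (ι × Bool), ∃ c : ℂ, Tendsto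
      (fun n => traceState (μ n) fun ω => starMonomial (fun i => M i n ω) w) atTop (𝓝 c) := by
    intro w
    by_cases hw : w = []
    · exact ⟨1, hw ▸ hnil⟩
    · exact hlim w hw
  choose c hc using hlim'
  -- Words form a basis of the free algebra, so the limits `c` extend linearly without any relation
  -- to check.
  let φ : FreeStarAlgebra ι →ₗ[ℂ] ℂ := (Finsupp.linearCombination ℂ fun w => c w.toList).comp
    (MonoidAlgebra.coeffLinearEquiv ℂ).toLinearMap
  have hφ : ∀ w r, φ (MonoidAlgebra.single w r) = r * c w.toList := fun w r => by
    simp [φ, MonoidAlgebra.coeffLinearEquiv]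
  have hint : ∀ (f : FreeStarAlgebra ι) n, Integrable
      (fun ω => (FreeStarAlgebra.eval (fun i => M i n ω) f).trace) (μ n) := by
    intro f n
    induction f using MonoidAlgebra.induction_linear with
    | zero => simp
    | add f g hf hg =>
      simp only [map_add, Matrix.trace_add]
      exact hf.add hg
    | single w r =>
      simp only [FreeStarAlgebra.eval_single, Matrix.trace_smul]
      refine (HasAllMoments.integrable ?_).fun_smul r
      exact .sum _ fun i _ => hasAllMoments_starMonomial (fun i => hM i n) _ _ _
  have hconv : ∀ f : FreeStarAlgebra ι, Tendsto (fun n => traceState (μ n) fun ω =>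
      FreeStarAlgebra.eval (fun i => M i n ω) f) atTop (𝓝 (φ f)) := by
    intro f
    induction f using MonoidAlgebra.induction_linear with
    | zero => simp [traceState]
    | add f g hf hg =>
      rw [map_add]
      refine (hf.add hg).congr fun n => ?_
      simp only [traceState, map_add, Matrix.trace_add, ← mul_add]
      rw [integral_add (hint f n) (hint g n)]
    | single w r =>
      rw [hφ]
      refine ((hc w.toList).const_mul r).congr fun n => ?_
      simp only [traceState, FreeStarAlgebra.eval_single, Matrix.trace_smul, smul_eq_mul,
        integral_const_mul]
      ring
  refine ⟨FreeStarAlgebra ι, inferInstance, inferInstance, inferInstance, inferInstance,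
    ⟨φ, ?_, fun f => ?_⟩, FreeStarAlgebra.gen, fun i n r s => hM i n r s, fun w _ => ?_⟩
  · rw [MonoidAlgebra.one_def, hφ, one_mul]
    exact tendsto_nhds_unique (hc []) hnil
  · refine ge_of_tendsto' (hconv (f * star f)) fun n => ?_
    simp only [map_mul, FreeStarAlgebra.eval_star]
    exact traceState_mul_star_nonneg _ _
  · rw [FreeStarAlgebra.starMonomial_gen, hφ, one_mul]
    exact hc w

end Criterion

/-! ### Lattice sums as integrals -/

section LatticeSums

variable {V : Type*}

/-- The scaling factor of a coordinate: `n` for the coordinates in `S`, and `1` for the others. -/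
noncomputable def latticeScale (S : Set V) (n : ℕ) (v : V) : ℝ :=
  open Classical in if v ∈ S then n else 1

/-- The lattice point below the point `x`, scaled by `n` in the coordinates in `S`. -/
noncomputable def latticePoint (S : Set V) (n : ℕ) (x : V → ℝ) (v : V) : ℤ :=
  ⌊latticeScale S n v * x v⌋

/-- The lattice points with coordinates between `-n` and `n`. -/
noncomputable def latticeBox (V : Type*) [Fintype V] [DecidableEq V] (n : ℕ) : Finset (V → ℤ) :=
  Fintype.piFinset fun _ => Finset.Icc (-n : ℤ) n

theorem latticeScale_pos (S : Set V) {n : ℕ} (hn : 1 ≤ n) (v : V) : 0 < latticeScale S n v := by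
  unfold latticeScale
  split
  · exact_mod_cast hn
  · exact one_pos

theorem measurable_latticePoint (S : Set V) (n : ℕ) : Measurable (latticePoint S n) :=
  measurable_pi_lambda _ fun v => Int.measurable_floor.comp
    ((measurable_pi_apply v).const_mul _)

theorem floor_mul_eq_iff {a : ℝ} (ha : 0 < a) (x : ℝ) (k : ℤ) :
    ⌊a * x⌋ = k ↔ x ∈ Set.Ico (k / a) ((k + 1) / a) := by
  rw [Int.floor_eq_iff, Set.mem_Ico, div_le_iff₀ ha, lt_div_iff₀ ha, mul_comm x]

theorem integral_floor_mul_eq {a : ℝ} (ha : 0 < a) (k : ℤ) :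
    ∫ x : ℝ, (if ⌊a * x⌋ = k then (1 : ℂ) else 0) = ((a⁻¹ : ℝ) : ℂ) := by
  have : (fun x : ℝ => if ⌊a * x⌋ = k then (1 : ℂ) else 0) =
      (Set.Ico (k / a) ((k + 1) / a)).indicator fun _ => 1 := by
    funext x
    simp only [Set.indicator, floor_mul_eq_iff ha]
  rw [this, integral_indicator measurableSet_Ico, setIntegral_const, measureReal_def,
    Real.volume_Ico, ENNReal.toReal_ofReal]
  · simp only [Complex.real_smul, mul_one]
    congr 1
    field_simp
    ring
  · rw [sub_nonneg]
    gcongr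
    linarith

theorem integrable_floor_mul_eq {a : ℝ} (ha : 0 < a) (k : ℤ) :
    Integrable (fun x : ℝ => if ⌊a * x⌋ = k then (1 : ℂ) else 0) := by
  by_contra h
  have := integral_floor_mul_eq ha k
  rw [integral_undef h] at this
  exact ha.ne' (by simpa using this.symm)

variable [Fintype V]

/-- A sum over lattice points is, up to normalization, an integral. -/
theorem sum_eq_integral_latticePoint (S : Set V) {n : ℕ} (hn : 1 ≤ n)
    (s : Finset (V → ℤ)) (f : (V → ℤ) → ℂ) (hf : ∀ u, u ∉ s → f u = 0) :
    ∑ u ∈ s, f u = ((∏ v, latticeScale S n v : ℝ) : ℂ) * ∫ x, f (latticePoint S n x) := by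
  classical
  have hpos := latticeScale_pos S hn
  -- The integrand is a finite combination of indicators of boxes. By Fubini, each box has as volume
  -- the product of the inverse scales.
  have hexp : ∀ x : V → ℝ, f (latticePoint S n x) =
      ∑ u ∈ s, f u * ∏ v, if ⌊latticeScale S n v * x v⌋ = u v then (1 : ℂ) else 0 := by
    intro x
    have h : ∀ u : V → ℤ, (∏ v, if ⌊latticeScale S n v * x v⌋ = u v then (1 : ℂ) else 0) =
        if latticePoint S n x = u then 1 else 0 := by
      intro u
      rw [Finset.prod_ite_zero]
      simp [funext_iff, latticePoint]
    simp only [h, mul_ite, mul_one, mul_zero, Finset.sum_ite_eq]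
    split
    · rfl
    · exact hf _ ‹_›
  simp only [hexp]
  rw [integral_finsetSum, Finset.mul_sum]
  · refine Finset.sum_congr rfl fun u _ => ?_
    rw [integral_const_mul, integral_fintype_prod_volume_eq_prod fun v (t : ℝ) =>
      if ⌊latticeScale S n v * t⌋ = u v then (1 : ℂ) else 0]
    simp only [integral_floor_mul_eq (hpos _)]
    rw [mul_left_comm, Complex.ofReal_prod, ← Finset.prod_mul_distrib, Finset.prod_eq_one, mul_one]
    intro v _
    rw [← Complex.ofReal_mul, mul_inv_cancel₀ (hpos v).ne', Complex.ofReal_one]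
  · intro u _
    refine Integrable.const_mul ?_ _
    exact Integrable.fintype_prod (f := fun v (t : ℝ) =>
      if ⌊latticeScale S n v * t⌋ = u v then (1 : ℂ) else 0)
      fun v => integrable_floor_mul_eq (hpos v) _

/-- The function is constant on each `[k, k + 1)`, so its integral is the series of `g`. -/
theorem integrable_comp_floor {g : ℤ → ℝ} (hg : Summable g) (h0 : ∀ k, 0 ≤ g k) :
    Integrable fun x : ℝ => g ⌊x⌋ := by
  rw [← integrableOn_univ, ← iUnion_Ico_intCast ℝ]
  have hcongr : ∀ k : ℤ, Set.EqOn (fun x : ℝ => g ⌊x⌋) (fun _ => g k) (Set.Ico (k : ℝ) (k + 1)) :=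
    fun k x hx => by
      have : ⌊x⌋ = k := Int.floor_eq_iff.2 hx
      simp [this]
  refine integrableOn_iUnion_of_summable_integral_norm (fun k => ?_) ?_
  · rw [integrableOn_congr_fun (hcongr k) measurableSet_Ico]
    exact integrableOn_const (by simp)
  · refine hg.congr fun k => ?_
    rw [setIntegral_congr_fun (g := fun _ => g k) measurableSet_Ico
      fun x hx => by simp only [hcongr k hx, Real.norm_eq_abs, abs_of_nonneg (h0 k)]]
    simp [measureReal_def]

/-- Convergence of lattice sums that are dominated by an integrable function and that converge
pointwise along the lattice points below almost every point. -/
theorem exists_tendsto_sum_latticeBox [DecidableEq V] (S : Set V) (F : ℕ → (V → ℤ) → ℂ)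
    (g : V → ℤ → ℝ) (hg : ∀ v, Summable (g v)) (h0 : ∀ v k, 0 ≤ g v k) (K : ℝ)
    (hbox : ∀ n u, u ∉ latticeBox V n → F n u = 0)
    (hbound : ∀ n, 1 ≤ n → ∀ u, ‖F n u‖ ≤ K * ∏ v, open Classical in if v ∈ S then 1 else g v (u v))
    (hlim : ∀ᵐ x : V → ℝ, ∃ c, Tendsto (fun n => F n (latticePoint S n x)) atTop (𝓝 c)) :
    ∃ c, Tendsto (fun n : ℕ => (((∏ v, latticeScale S n v)⁻¹ : ℝ) : ℂ) * ∑ u ∈ latticeBox V n, F n u)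
      atTop (𝓝 c) := by
  classical
  -- In a scaled coordinate, `-n ≤ ⌊n t⌋ ≤ n` forces `-1 ≤ t < 1 + 1 / n`, hence `t ∈ [-1, 2]` for
  -- all `n ≥ 1`.
  let b : V → ℝ → ℝ := fun v t => if v ∈ S then (Set.Icc (-1) 2).indicator 1 t else g v ⌊t⌋
  have hb : Integrable fun x : V → ℝ => max K 0 * ∏ v, b v (x v) := by
    refine Integrable.const_mul ?_ _
    refine Integrable.fintype_prod (f := b) fun v => ?_
    by_cases hv : v ∈ S
    · simp only [b, hv, if_true]
      exact (integrable_indicator_iff measurableSet_Icc).2 (integrableOn_const (by simp))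
    · simp only [b, hv, if_false]
      exact integrable_comp_floor (hg v) (h0 v)
  have hb0 : ∀ v t, 0 ≤ b v t := by
    intro v t
    simp only [b]
    split
    · exact Set.indicator_nonneg (fun _ _ => zero_le_one) t
    · exact h0 _ _
  have hmain := tendsto_integral_filter_of_dominated_convergence (μ := volume) (l := atTop)
    (F := fun n x => F n (latticePoint S n x))
    -- The pointwise limit is only known to exist almost everywhere; `limUnder` takes a junk value
    -- elsewhere.
    (f := fun x => limUnder atTop fun n => F n (latticePoint S n x))
    (fun x : V → ℝ => max K 0 * ∏ v, b v (x v)) ?_ ?_ hb ?_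
  · refine ⟨_, hmain.congr' ?_⟩
    filter_upwards [eventually_ge_atTop 1] with n hn
    rw [sum_eq_integral_latticePoint S hn _ _ (hbox n), ← mul_assoc, ← Complex.ofReal_mul,
      inv_mul_cancel₀ (Finset.prod_ne_zero_iff.2 fun v _ => (latticeScale_pos S hn v).ne')]
    simp
  · refine Eventually.of_forall fun n => Measurable.aestronglyMeasurable ?_
    exact (measurable_of_countable (F n)).comp (measurable_latticePoint S n)
  · filter_upwards [eventually_ge_atTop 1] with n hn
    refine Eventually.of_forall fun x => ?_
    by_cases hx : latticePoint S n x ∈ latticeBox V n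
    · refine (hbound n hn _).trans ?_
      refine mul_le_mul (le_max_left _ _) ?_ (Finset.prod_nonneg fun v _ => ?_) (le_max_right _ _)
      · refine Finset.prod_le_prod (fun v _ => ?_) fun v _ => ?_
        · split
          · exact zero_le_one
          · exact h0 _ _
        · by_cases hv : v ∈ S
          · have h := Finset.mem_Icc.1 (Fintype.mem_piFinset.1 hx v)
            have hn' : (1 : ℝ) ≤ n := by exact_mod_cast hn
            simp only [latticePoint, latticeScale, hv, if_true] at h
            have h1 : -(n : ℝ) ≤ n * x v := by
              have := Int.le_floor.1 h.1
              push_cast at this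
              exact this
            have h2 : n * x v < n + 1 := by
              have := Int.floor_lt.1 (Int.lt_add_one_of_le h.2)
              push_cast at this
              exact this
            have hmem : x v ∈ Set.Icc (-1 : ℝ) 2 := ⟨by nlinarith, by nlinarith⟩
            simp [b, hv, hmem]
          · simp [b, hv, latticePoint, latticeScale]
      · split
        · exact zero_le_one
        · exact h0 _ _
    · rw [hbox n _ hx, norm_zero]
      exact mul_nonneg (le_max_right _ _) (Finset.prod_nonneg fun v _ => hb0 _ _)
  · filter_upwards [hlim] with x hx
    exact tendsto_nhds_limUnder hx

end LatticeSums

/-! ### Affine forms at lattice points -/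

/-- A sequence of propositions that is eventually true or eventually false. -/
def EventuallyDecided (P : ℕ → Prop) : Prop := (∀ᶠ n in atTop, P n) ∨ ∀ᶠ n in atTop, ¬ P n

theorem EventuallyDecided.not {P : ℕ → Prop} (hP : EventuallyDecided P) :
    EventuallyDecided fun n => ¬ P n := by
  unfold EventuallyDecided at *
  simpa only [not_not] using hP.symm

theorem EventuallyDecided.and {P Q : ℕ → Prop} (hP : EventuallyDecided P)
    (hQ : EventuallyDecided Q) : EventuallyDecided fun n => P n ∧ Q n := by
  rcases hP with hP | hP
  · rcases hQ with hQ | hQ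
    · exact Or.inl (hP.and hQ)
    · exact Or.inr (hQ.mono fun n h h' => h h'.2)
  · exact Or.inr (hP.mono fun n h h' => h h'.1)

theorem EventuallyDecided.congr {P Q : ℕ → Prop} (hP : EventuallyDecided P)
    (h : ∀ n, P n ↔ Q n) : EventuallyDecided Q := by
  simpa only [EventuallyDecided, h] using hP

theorem EventuallyDecided.const (p : Prop) : EventuallyDecided fun _ => p := by
  by_cases hp : p
  · exact Or.inl (.of_forall fun _ => hp)
  · exact Or.inr (.of_forall fun _ => hp)

theorem EventuallyDecided.all {κ : Type*} [Finite κ] {P : κ → ℕ → Prop}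
    (hP : ∀ k, EventuallyDecided (P k)) : EventuallyDecided fun n => ∀ k, P k n := by
  by_cases h : ∀ k, ∀ᶠ n in atTop, P k n
  · exact Or.inl (eventually_all.2 h)
  · obtain ⟨k, hk⟩ := not_forall.1 h
    exact Or.inr (((hP k).resolve_left hk).mono fun n hn hall => hn (hall k))

/-- A sequence that is eventually constant in the truth value of `P n`. -/
theorem EventuallyDecided.eventually_iff {P : ℕ → Prop} (hP : EventuallyDecided P) :
    ∃ p : Prop, ∀ᶠ n in atTop, (P n ↔ p) := by
  rcases hP with hP | hP
  · exact ⟨True, hP.mono fun n h => by simp [h]⟩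
  · exact ⟨False, hP.mono fun n h => by simp [h]⟩

section Affine

variable {V : Type*} [Fintype V]

/-- A function of `n` and of a lattice point that is affine with integer coefficients. -/
def IsIntAffine (f : ℕ → (V → ℤ) → ℤ) : Prop :=
  ∃ (A : V → ℤ) (d e : ℤ), ∀ n u, f n u = ∑ v, A v * u v + d * n + e

theorem IsIntAffine.coord [DecidableEq V] (v : V) : IsIntAffine fun _ u => u v :=
  ⟨Pi.single v 1, 0, 0, fun n u => by simp [Pi.single_apply]⟩

theorem IsIntAffine.const (e : ℤ) : IsIntAffine fun _ (_ : V → ℤ) => e :=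
  ⟨0, 0, e, fun n u => by simp⟩

theorem IsIntAffine.size : IsIntAffine fun n (_ : V → ℤ) => (n : ℤ) :=
  ⟨0, 1, 0, fun n u => by simp⟩

theorem IsIntAffine.add {f g : ℕ → (V → ℤ) → ℤ} (hf : IsIntAffine f) (hg : IsIntAffine g) :
    IsIntAffine fun n u => f n u + g n u := by
  obtain ⟨A, d, e, h⟩ := hf
  obtain ⟨A', d', e', h'⟩ := hg
  refine ⟨A + A', d + d', e + e', fun n u => ?_⟩
  simp only [h, h', Pi.add_apply, add_mul, Finset.sum_add_distrib]
  ring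

theorem IsIntAffine.neg {f : ℕ → (V → ℤ) → ℤ} (hf : IsIntAffine f) :
    IsIntAffine fun n u => - f n u := by
  obtain ⟨A, d, e, h⟩ := hf
  refine ⟨-A, -d, -e, fun n u => ?_⟩
  simp only [h, Pi.neg_apply, neg_mul, Finset.sum_neg_distrib]
  ring

theorem IsIntAffine.sub {f g : ℕ → (V → ℤ) → ℤ} (hf : IsIntAffine f) (hg : IsIntAffine g) :
    IsIntAffine fun n u => f n u - g n u := by
  simpa only [sub_eq_add_neg] using hf.add hg.neg

/-- The set is an affine subspace, and it is proper: otherwise comparing `0` with a basis vector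
would give `A = 0`. -/
theorem volume_affine_eq_zero (A : V → ℝ) (d : ℝ) (hA : A ≠ 0) :
    volume {x : V → ℝ | ∑ v, A v * x v + d = 0} = 0 := by
  classical
  obtain ⟨v, hv⟩ := Function.ne_iff.1 hA
  let ℓ : (V → ℝ) →ₗ[ℝ] ℝ := Fintype.linearCombination ℝ A
  have hℓ : ∀ x, ℓ x = ∑ v, A v * x v := fun x => by
    simp [ℓ, Fintype.linearCombination_apply, mul_comm]
  let s : AffineSubspace ℝ (V → ℝ) := AffineSubspace.comap ℓ.toAffineMap
    (AffineSubspace.mk' (-d) ⊥)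
  have hs : (s : Set (V → ℝ)) = {x | ∑ v, A v * x v + d = 0} := by
    ext x
    simp [s, hℓ, AffineSubspace.mem_mk']
  rw [← hs]
  refine Measure.addHaar_affineSubspace volume s fun htop => ?_
  have hall : ∀ x : V → ℝ, ∑ v, A v * x v + d = 0 := by
    intro x
    have : x ∈ (s : Set (V → ℝ)) := by rw [htop]; trivial
    rwa [hs] at this
  have h0 := hall 0
  have h1 := hall (Pi.single v 1)
  simp [Pi.single_apply] at h0 h1
  exact hv (by simpa [h0] using h1)

theorem tendsto_floor_nat_mul_div (x : ℝ) :
    Tendsto (fun n : ℕ => (⌊(n : ℝ) * x⌋ : ℝ) / n) atTop (𝓝 x) := by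
  have h : Tendsto (fun n : ℕ => x - 1 / (n : ℝ)) atTop (𝓝 x) := by
    simpa using tendsto_const_nhds.sub (tendsto_const_div_atTop_nhds_zero_nat (1 : ℝ))
  refine tendsto_of_tendsto_of_tendsto_of_le_of_le' h tendsto_const_nhds ?_ ?_
  · filter_upwards [eventually_gt_atTop 0] with n hn
    have hn' : (0 : ℝ) < n := by exact_mod_cast hn
    rw [le_div_iff₀ hn', sub_mul, div_mul_cancel₀ _ hn'.ne', mul_comm]
    exact (Int.sub_one_lt_floor _).le
  · filter_upwards [eventually_gt_atTop 0] with n hn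
    have hn' : (0 : ℝ) < n := by exact_mod_cast hn
    rw [div_le_iff₀ hn', mul_comm x]
    exact Int.floor_le _

/-- If no scaling coordinate occurs, the form is `d n` plus a constant. Otherwise, divided by `n`,
it converges to a nontrivial real affine form in `x`, which is nonzero off a null hyperplane; the
sign of the limit decides. -/
theorem ae_eventuallyDecided_affine (S : Set V) (A : V → ℤ) (d e : ℤ) :
    ∀ᵐ x : V → ℝ, EventuallyDecided fun n =>
      0 ≤ ∑ v, A v * latticePoint S n x v + d * n + e := by
  classical
  by_cases hA : ∀ v ∈ S, A v = 0
  · refine Eventually.of_forall fun x => ?_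
    have hconst : ∀ n : ℕ, ∑ v, A v * latticePoint S n x v = ∑ v, A v * ⌊x v⌋ := by
      intro n
      refine Finset.sum_congr rfl fun v _ => ?_
      by_cases hv : v ∈ S
      · simp [hA v hv]
      · simp [latticePoint, latticeScale, hv]
    simp only [hconst]
    generalize ∑ v, A v * ⌊x v⌋ = a
    -- If `d ≠ 0` then `|d| ≥ 1`, so `d n` outweighs the constant `a + e` once `n` exceeds its
    -- absolute value.
    rcases lt_trichotomy d 0 with hd | rfl | hd
    · right
      filter_upwards [eventually_gt_atTop (a + e).toNat] with n hn
      have : a + e < n := by omega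
      nlinarith
    · simpa using EventuallyDecided.const (0 ≤ a + e)
    · left
      filter_upwards [eventually_gt_atTop (-(a + e)).toNat] with n hn
      have : -(a + e) < n := by omega
      nlinarith
  · push Not at hA
    obtain ⟨v₀, hv₀, hne⟩ := hA
    -- Only the scaling coordinates survive the division by `n`.
    let A' : V → ℝ := fun v => if v ∈ S then A v else 0
    have hA' : A' ≠ 0 := Function.ne_iff.2 ⟨v₀, by simpa [A', hv₀] using hne⟩
    have hnull := volume_affine_eq_zero A' d hA'
    filter_upwards [measure_eq_zero_iff_ae_notMem.1 hnull] with x hx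
    have hterm : ∀ v, Tendsto (fun n : ℕ => (A v : ℝ) * (latticePoint S n x v : ℝ) / n) atTop
        (𝓝 (A' v * x v)) := by
      intro v
      by_cases hv : v ∈ S
      · simp only [A', hv, if_true, latticePoint, latticeScale, mul_div_assoc]
        exact (tendsto_floor_nat_mul_div (x v)).const_mul _
      · simp only [A', hv, if_false, latticePoint, latticeScale, zero_mul, one_mul]
        exact tendsto_const_div_atTop_nhds_zero_nat _
    have hsum : Tendsto (fun n : ℕ =>
        ((∑ v, A v * latticePoint S n x v + d * n + e : ℤ) : ℝ) / n) atTop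
        (𝓝 (∑ v, A' v * x v + d)) := by
      have h := ((tendsto_finsetSum Finset.univ fun v _ => hterm v).add
        (tendsto_const_nhds (x := (d : ℝ)))).add (tendsto_const_div_atTop_nhds_zero_nat (e : ℝ))
      rw [add_zero] at h
      refine h.congr' ?_
      filter_upwards [eventually_gt_atTop 0] with n hn
      have : (n : ℝ) ≠ 0 := by exact_mod_cast hn.ne'
      push_cast
      rw [add_div, add_div, Finset.sum_div, mul_div_cancel_right₀ _ this]
    rcases lt_or_gt_of_ne (show ∑ v, A' v * x v + d ≠ 0 from hx) with h | h
    · right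
      filter_upwards [hsum.eventually_lt_const h, eventually_gt_atTop 0] with n hn hn0
      have : (0 : ℝ) < n := by exact_mod_cast hn0
      rw [div_lt_iff₀ this, zero_mul] at hn
      rw [not_le]
      exact_mod_cast hn
    · left
      filter_upwards [hsum.eventually_const_lt h, eventually_gt_atTop 0] with n hn hn0
      have : (0 : ℝ) < n := by exact_mod_cast hn0
      rw [lt_div_iff₀ this, zero_mul] at hn
      exact_mod_cast hn.le

/-- For almost every `x`, every inequality between integer affine functions at the lattice points
below `x` is eventually true or eventually false. -/
theorem ae_forall_eventuallyDecided_nonneg (S : Set V) :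
    ∀ᵐ x : V → ℝ, ∀ f : ℕ → (V → ℤ) → ℤ, IsIntAffine f →
      EventuallyDecided fun n => 0 ≤ f n (latticePoint S n x) := by
  -- There are only countably many integer coefficient vectors, so one null set serves all forms.
  have h : ∀ᵐ x : V → ℝ, ∀ p : (V → ℤ) × ℤ × ℤ, EventuallyDecided fun n =>
      0 ≤ ∑ v, p.1 v * latticePoint S n x v + p.2.1 * n + p.2.2 :=
    ae_all_iff.2 fun p => ae_eventuallyDecided_affine S p.1 p.2.1 p.2.2
  filter_upwards [h] with x hx f ⟨A, d, e, hf⟩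
  simpa only [hf] using hx (A, d, e)

end Affine

/-! ### Traces of products as sums over paths -/

theorem Matrix.list_ofFn_prod_apply {n L : ℕ} (M : Fin L → Matrix (Fin n) (Fin n) ℂ) (i j : Fin n) :
    (List.ofFn M).prod i j = ∑ p : Fin (L + 1) → Fin n,
      if p 0 = i ∧ p (Fin.last L) = j then ∏ l, M l (p l.castSucc) (p l.succ) else 0 := by
  induction L generalizing i with
  | zero =>
    rw [← (Equiv.funUnique (Fin 1) (Fin n)).symm.sum_comp]
    simp only [List.ofFn_zero, List.prod_nil, Matrix.one_apply]
    rw [Finset.sum_eq_single i]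
    · simp [eq_comm]
    · intro b _ hb
      simp [hb]
    · simp
  | succ L ih =>
    rw [List.ofFn_succ, List.prod_cons, Matrix.mul_apply, ← (Fin.consEquiv fun _ => Fin n).sum_comp,
      Fintype.sum_prod_type]
    trans ∑ p : Fin (L + 1) → Fin n, if p (Fin.last L) = j then
      M 0 i (p 0) * ∏ l : Fin L, M l.succ (p l.castSucc) (p l.succ) else 0
    · simp only [ih, Finset.mul_sum]
      rw [Finset.sum_comm]
      refine Finset.sum_congr rfl fun p _ => ?_
      rw [Finset.sum_eq_single (p 0)]
      · simp
      · intro b _ hb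
        simp [hb.symm]
      · simp
    · symm
      rw [Finset.sum_eq_single i]
      · refine Finset.sum_congr rfl fun p _ => ?_
        simp only [Fin.consEquiv_apply, Fin.cons_zero, true_and, ← Fin.succ_last, Fin.cons_succ]
        rw [Fin.prod_univ_succ]
        simp only [Fin.castSucc_zero, Fin.cons_zero, Fin.cons_succ, ← Fin.succ_castSucc]
      · intro b _ hb
        simp [hb]
      · simp

theorem Matrix.trace_list_ofFn_prod {n L : ℕ} (M : Fin L → Matrix (Fin n) (Fin n) ℂ) :
    (List.ofFn M).prod.trace = ∑ p : Fin (L + 1) → Fin n,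
      if p 0 = p (Fin.last L) then ∏ l, M l (p l.castSucc) (p l.succ) else 0 := by
  simp only [Matrix.trace, Matrix.diag, Matrix.list_ofFn_prod_apply]
  rw [Finset.sum_comm]
  refine Finset.sum_congr rfl fun p _ => ?_
  rw [Finset.sum_eq_single (p 0)]
  · simp [eq_comm]
  · intro b _ hb
    simp [hb.symm]
  · simp

/-! ### Step variables -/

section Paths

variable {m L : ℕ}

/-- The index of the input that the letter `x` reads off at row `p` and column `q`. -/
def stepIndex (n : ℕ) (x : MatrixLabel m × Bool) (p q : ℤ) : ℤ :=
  match x.1 with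
  -- This vanishes exactly on the antidiagonal, so `P_n` becomes a letter with the summable input
  -- `δ₀`.
  | .perm => n - 1 - p - q
  | .rand _ => if x.2 then q - p else p - q
  | .det _ => if x.2 then q - p else p - q

/-- The column at which the letter `x` reads off the input `u` in the row `p`. -/
def nextPosition (n : ℕ) (x : MatrixLabel m × Bool) (p u : ℤ) : ℤ :=
  match x.1 with
  | .perm => n - 1 - p - u
  | .rand _ => if x.2 then p + u else p - u
  | .det _ => if x.2 then p + u else p - u

/-- For a fixed row, column and input index determine each other. Together with
`stepIndex_nextPosition`, this makes the starting point and the inputs coordinates on the set of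
paths. -/
theorem nextPosition_stepIndex (n : ℕ) (x : MatrixLabel m × Bool) (p q : ℤ) :
    nextPosition n x p (stepIndex n x p q) = q := by
  obtain ⟨_ | _ | _, _ | _⟩ := x <;> simp [nextPosition, stepIndex]

theorem stepIndex_nextPosition (n : ℕ) (x : MatrixLabel m × Bool) (p u : ℤ) :
    stepIndex n x p (nextPosition n x p u) = u := by
  obtain ⟨_ | _ | _, _ | _⟩ := x <;> simp [nextPosition, stepIndex]

theorem stepIndex_mem_Icc {n : ℕ} (x : MatrixLabel m × Bool) (p q : Fin n) :
    stepIndex n x p q ∈ Finset.Icc (-n : ℤ) n := by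
  have hp := p.2
  have hq := q.2
  rw [Finset.mem_Icc]
  obtain ⟨_ | _ | _, _ | _⟩ := x <;> simp only [stepIndex] <;> constructor <;> simp <;> omega

/-- The path that starts at `y none` and whose `l`-th step reads off the input `y (some l)`. -/
def latticePath (n : ℕ) (x : Fin L → MatrixLabel m × Bool) (y : Option (Fin L) → ℤ) : ℕ → ℤ
  | 0 => y none
  | l + 1 => if h : l < L then nextPosition n (x ⟨l, h⟩) (latticePath n x y l) (y (some ⟨l, h⟩))
      else 0

theorem latticePath_succ (n : ℕ) (x : Fin L → MatrixLabel m × Bool) (y : Option (Fin L) → ℤ)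
    (l : Fin L) : latticePath n x y (l + 1) =
      nextPosition n (x l) (latticePath n x y l) (y (some l)) := by
  simp [latticePath]

/-- The path stays in the range of the matrix indices. -/
def IsValidPath (n : ℕ) (x : Fin L → MatrixLabel m × Bool) (y : Option (Fin L) → ℤ) : Prop :=
  ∀ l : Fin (L + 1), 0 ≤ latticePath n x y l ∧ latticePath n x y l < n

/-- The starting point and the inputs read off along a path. -/
def pathInputs {n : ℕ} (x : Fin L → MatrixLabel m × Bool) (p : Fin (L + 1) → Fin n) :
    Option (Fin L) → ℤ
  | none => p 0
  | some l => stepIndex n (x l) (p l.castSucc) (p l.succ)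

theorem latticePath_pathInputs {n : ℕ} (x : Fin L → MatrixLabel m × Bool)
    (p : Fin (L + 1) → Fin n) (l : Fin (L + 1)) :
    latticePath n x (pathInputs x p) l = p l := by
  induction l using Fin.induction with
  | zero => rfl
  | succ l ih =>
    rw [Fin.val_succ, latticePath_succ, ← Fin.val_castSucc, ih, pathInputs, nextPosition_stepIndex]

open Classical in
-- A path can be recovered from `pathInputs`, and `IsValidPath` cuts out the image. All indices read
-- off by a path of matrix indices have modulus at most `n`, so restricting to the box loses
-- nothing.
theorem sum_paths_eq_sum_latticeBox (n : ℕ) (x : Fin L → MatrixLabel m × Bool)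
    (H : (Fin (L + 1) → ℤ) → ℂ) :
    ∑ p : Fin (L + 1) → Fin n, H (fun l => p l) = ∑ y ∈ latticeBox (Option (Fin L)) n,
      if IsValidPath n x y then H (fun l => latticePath n x y l) else 0 := by
  rw [← Finset.sum_filter]
  refine Finset.sum_bij (fun p _ => pathInputs x p) (fun p _ => ?_) (fun p _ p' _ h => ?_)
    (fun y hy => ?_) (fun p _ => ?_)
  · rw [Finset.mem_filter]
    refine ⟨Fintype.mem_piFinset.2 fun o => ?_, fun l => ?_⟩
    · cases o with
      | none =>
        have := (p 0).2
        rw [pathInputs, Finset.mem_Icc]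
        omega
      | some l => exact stepIndex_mem_Icc _ _ _
    · rw [latticePath_pathInputs]
      have := (p l).2
      omega
  · funext l
    have := latticePath_pathInputs x p l
    rw [h, latticePath_pathInputs] at this
    exact Fin.ext (by exact_mod_cast this.symm)
  · have hv := (Finset.mem_filter.1 hy).2
    refine ⟨fun l => ⟨(latticePath n x y l).toNat, by have := hv l; omega⟩, Finset.mem_univ _, ?_⟩
    have hc : ∀ l : Fin (L + 1), (((latticePath n x y l).toNat : ℕ) : ℤ) = latticePath n x y l :=
      fun l => Int.toNat_of_nonneg (hv l).1
    funext o
    cases o with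
    | none => exact hc 0
    | some l =>
      simp only [pathInputs, hc]
      rw [Fin.val_succ, latticePath_succ, Fin.val_castSucc, stepIndex_nextPosition]
  · simp only [latticePath_pathInputs]

end Paths

/-! ### Grouping by coinciding inputs -/

section Grouping

variable {m L : ℕ}

/-- The index of the independent copy that a letter refers to, if the letter is random. -/
def copyIndex (x : MatrixLabel m × Bool) : Option (Fin m) :=
  match x.1 with
  | .perm => none
  | .rand c => some c
  | .det _ => none

/-- The random input that is read off at a position; at deterministic letters the position itself.
Two positions read off the same random input if and only if they have the same key. -/
def inputKey (x : Fin L → MatrixLabel m × Bool) (u : Fin L → ℤ) (l : Fin L) :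
    (Fin m × ℤ) ⊕ Fin L :=
  match copyIndex (x l) with
  | some c => .inl (c, u l)
  | none => .inr l

theorem inputKey_of_copyIndex_eq_none {x : Fin L → MatrixLabel m × Bool} {l : Fin L}
    (h : copyIndex (x l) = none) (u : Fin L → ℤ) : inputKey x u l = .inr l := by
  simp [inputKey, h]

theorem inputKey_of_copyIndex_eq_some {x : Fin L → MatrixLabel m × Bool} {l : Fin L} {c : Fin m}
    (h : copyIndex (x l) = some c) (u : Fin L → ℤ) : inputKey x u l = .inl (c, u l) := by
  simp [inputKey, h]

theorem inputKey_eq_iff (x : Fin L → MatrixLabel m × Bool) (u : Fin L → ℤ) (l l' : Fin L) :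
    inputKey x u l = inputKey x u l' ↔
      l = l' ∨ copyIndex (x l) ≠ none ∧ copyIndex (x l) = copyIndex (x l') ∧ u l = u l' := by
  rcases h : copyIndex (x l) with _ | c <;> rcases h' : copyIndex (x l') with _ | c'
  · simp [inputKey_of_copyIndex_eq_none h, inputKey_of_copyIndex_eq_none h']
  · simp only [inputKey_of_copyIndex_eq_none h, inputKey_of_copyIndex_eq_some h']
    simp only [reduceCtorEq, ne_eq, not_true_eq_false, false_and, or_false, false_iff]
    rintro rfl
    simp [h] at h'
  · simp only [inputKey_of_copyIndex_eq_some h, inputKey_of_copyIndex_eq_none h']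
    simp only [reduceCtorEq, ne_eq, false_and, and_false, or_false, false_iff]
    rintro rfl
    simp [h] at h'
  · simp only [inputKey_of_copyIndex_eq_some h, inputKey_of_copyIndex_eq_some h', Sum.inl.injEq,
      Prod.mk.injEq, ne_eq, reduceCtorEq, not_false_eq_true, true_and, Option.some.injEq]
    constructor
    · exact Or.inr
    · rintro (rfl | h'')
      · simp_all
      · exact h''

theorem eq_of_inputKey_eq {x : Fin L → MatrixLabel m × Bool} {u : Fin L → ℤ} {l l' : Fin L}
    (h : inputKey x u l = inputKey x u l') : u l = u l' := by
  rcases (inputKey_eq_iff x u l l').1 h with rfl | h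
  · rfl
  · exact h.2.2

theorem copyIndex_eq_of_inputKey_eq {x : Fin L → MatrixLabel m × Bool} {u : Fin L → ℤ}
    {l l' : Fin L} (h : inputKey x u l = inputKey x u l') :
    copyIndex (x l) = copyIndex (x l') := by
  rcases (inputKey_eq_iff x u l l').1 h with rfl | h
  · rfl
  · exact h.2.1

instance finite_setoid {α : Type*} [Finite α] : Finite (Setoid α) :=
  Finite.of_injective (fun π : Setoid α => π.r) fun _ _ h =>
    Setoid.ext fun a b => iff_of_eq (congrFun (congrFun h a) b)

/-- Read off the same input at all positions of a block. -/
def blockInputs (π : Setoid (Fin L)) (t : Option (Quotient π) → ℤ) (o : Option (Fin L)) : ℤ :=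
  t (o.map (Quotient.mk π))

open Classical in
-- Each `y` belongs to exactly one partition, the kernel of its keys, and is constant on the blocks.
-- It is therefore given by its starting point and one integer per block.
theorem sum_latticeBox_eq_sum_setoid [Fintype (Setoid (Fin L))] (n : ℕ)
    (x : Fin L → MatrixLabel m × Bool) (G : (Option (Fin L) → ℤ) → ℂ) :
    ∑ y ∈ latticeBox (Option (Fin L)) n, G y = ∑ π : Setoid (Fin L),
      ∑ t ∈ latticeBox (Option (Quotient π)) n,
        if Setoid.ker (inputKey x fun l => blockInputs π t (some l)) = π then G (blockInputs π t)
        else 0 := by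
  rw [← Finset.sum_fiberwise _ fun y => Setoid.ker (inputKey x fun l => y (some l))]
  refine Finset.sum_congr rfl fun π _ => ?_
  rw [← Finset.sum_filter]
  symm
  refine Finset.sum_bij (fun t _ => blockInputs π t) (fun t ht => ?_) (fun t _ t' _ h => ?_)
    (fun y hy => ?_) (fun t _ => rfl)
  · rw [Finset.mem_filter] at ht ⊢
    exact ⟨Fintype.mem_piFinset.2 fun o => Fintype.mem_piFinset.1 ht.1 _, ht.2⟩
  · funext o
    cases o with
    | none => exact congrFun h none
    | some β =>
      induction β using Quotient.inductionOn with
      | h l => exact congrFun h (some l)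
  · rw [Finset.mem_filter] at hy
    -- Sampling `y` at block representatives recovers `y`, because equal keys entail equal inputs.
    have hout : blockInputs π (fun o => y (o.map Quotient.out)) = y := by
      funext o
      cases o with
      | none => rfl
      | some l =>
        have hrel : (Setoid.ker (inputKey x fun l => y (some l))) (Quotient.mk π l).out l := by
          rw [hy.2]
          exact Quotient.mk_out l
        exact eq_of_inputKey_eq (u := fun l => y (some l)) hrel
    refine ⟨fun o => y (o.map Quotient.out), ?_, hout⟩
    rw [Finset.mem_filter, hout]
    exact ⟨Fintype.mem_piFinset.2 fun o => Fintype.mem_piFinset.1 hy.1 _, hy.2⟩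

end Grouping

/-! ### Asymptotics of sums over paths -/

theorem EventuallyDecided.or {P Q : ℕ → Prop} (hP : EventuallyDecided P)
    (hQ : EventuallyDecided Q) : EventuallyDecided fun n => P n ∨ Q n :=
  (hP.not.and hQ.not).not.congr fun n => by tauto

theorem EventuallyDecided.iff_const {P : ℕ → Prop} (hP : EventuallyDecided P) (q : Prop) :
    EventuallyDecided fun n => P n ↔ q := by
  by_cases hq : q
  · simpa [hq] using hP
  · simpa [hq] using hP.not

section Asymptotics

variable {m L : ℕ}

/-- The positions of the random letters. -/
def randomPositions (x : Fin L → MatrixLabel m × Bool) : Finset (Fin L) :=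
  Finset.univ.filter fun l => copyIndex (x l) ≠ none

theorem mem_randomPositions {x : Fin L → MatrixLabel m × Bool} {l : Fin L} :
    l ∈ randomPositions x ↔ copyIndex (x l) ≠ none := by
  simp [randomPositions]

/-- Whether a step of the path is read off above the antidiagonal. -/
def pathSide (n : ℕ) (x : Fin L → MatrixLabel m × Bool) (y : Option (Fin L) → ℤ) (l : Fin L) :
    Bool :=
  decide (latticePath n x y l + latticePath n x y (l + 1) + 2 ≤ n)

/-- The contribution of a path to the trace: `W` are the weights of the deterministic letters, and
`Φ` the expectations of the products of the random inputs. -/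
noncomputable def pathWeight (x : Fin L → MatrixLabel m × Bool) (W : Fin L → Bool → ℤ → ℂ)
    (Φ : ℕ → (Fin L → ℤ) → (Fin L → Bool) → ℂ) (n : ℕ) (y : Option (Fin L) → ℤ) : ℂ :=
  open Classical in
  if IsValidPath n x y ∧ latticePath n x y 0 = latticePath n x y L then
    (∏ l, W l (pathSide n x y l) (y (some l))) * Φ n (fun l => y (some l)) (pathSide n x y)
  else 0

/-- Every random position has exactly one partner. -/
def IsPairing (x : Fin L → MatrixLabel m × Bool) (π : Setoid (Fin L)) : Prop :=
  ∀ l, copyIndex (x l) ≠ none → ∃ l', l' ≠ l ∧ ∀ k, π l k ↔ k = l ∨ k = l'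

/-- The blocks of random positions. -/
noncomputable def randomBlocks (x : Fin L → MatrixLabel m × Bool) (π : Setoid (Fin L)) :
    Finset (Quotient π) :=
  open Classical in (randomPositions x).image (Quotient.mk π)

/-- The coordinates that scale with the size of the matrices. -/
def scalingCoordinates (x : Fin L → MatrixLabel m × Bool) (π : Setoid (Fin L)) :
    Set (Option (Quotient π)) :=
  {v | v.elim True (· ∈ randomBlocks x π)}

theorem none_mem_scalingCoordinates (x : Fin L → MatrixLabel m × Bool) (π : Setoid (Fin L)) :
    none ∈ scalingCoordinates x π := trivial

theorem some_mem_scalingCoordinates {x : Fin L → MatrixLabel m × Bool} {π : Setoid (Fin L)}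
    {β : Quotient π} : some β ∈ scalingCoordinates x π ↔ β ∈ randomBlocks x π := Iff.rfl

/-! ### Counting blocks and coordinates of a partition -/

section Blocks

variable {x : Fin L → MatrixLabel m × Bool} {π : Setoid (Fin L)}

theorem copyIndex_eq_of_rel (hπ : ∃ u, Setoid.ker (inputKey x u) = π) {l l' : Fin L}
    (h : π l l') : copyIndex (x l) = copyIndex (x l') := by
  obtain ⟨u, rfl⟩ := hπ
  exact copyIndex_eq_of_inputKey_eq h

theorem eq_of_rel_of_copyIndex_eq_none (hπ : ∃ u, Setoid.ker (inputKey x u) = π) {l l' : Fin L}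
    (h : π l l') (hl : copyIndex (x l) = none) : l = l' := by
  obtain ⟨u, rfl⟩ := hπ
  rcases (inputKey_eq_iff x u l l').1 h with h | h
  · exact h
  · exact absurd hl h.1

theorem mk_mem_randomBlocks (hπ : ∃ u, Setoid.ker (inputKey x u) = π) (l : Fin L) :
    Quotient.mk π l ∈ randomBlocks x π ↔ copyIndex (x l) ≠ none := by
  classical
  simp only [randomBlocks, Finset.mem_image, mem_randomPositions]
  constructor
  · rintro ⟨l', hl', h⟩
    rwa [← copyIndex_eq_of_rel hπ (Quotient.exact h)]
  · exact fun h => ⟨l, h, rfl⟩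

open Classical in
theorem two_le_card_fiber (hπ : ∃ u, Setoid.ker (inputKey x u) = π)
    (hs : ∀ l, copyIndex (x l) ≠ none → ∃ l', π l l' ∧ l' ≠ l) {β : Quotient π}
    (hβ : β ∈ randomBlocks x π) :
    2 ≤ ((randomPositions x).filter fun l => Quotient.mk π l = β).card := by
  obtain ⟨l, hl, rfl⟩ := Finset.mem_image.1 hβ
  rw [mem_randomPositions] at hl
  obtain ⟨l', h, hne⟩ := hs l hl
  refine Finset.one_lt_card.2 ⟨l, ?_, l', ?_, hne.symm⟩
  · simpa [mem_randomPositions] using hl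
  · rw [Finset.mem_filter, mem_randomPositions, ← copyIndex_eq_of_rel hπ h]
    exact ⟨hl, Quotient.sound (π.symm h)⟩

/-- Every block of random positions has at least two elements. -/
theorem two_mul_card_randomBlocks_le (hπ : ∃ u, Setoid.ker (inputKey x u) = π)
    (hs : ∀ l, copyIndex (x l) ≠ none → ∃ l', π l l' ∧ l' ≠ l) :
    2 * (randomBlocks x π).card ≤ (randomPositions x).card := by
  classical
  rw [Finset.card_eq_sum_card_image (Quotient.mk π) (randomPositions x), mul_comm]
  exact Finset.card_nsmul_le_sum _ _ _ fun β hβ => two_le_card_fiber hπ hs hβ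

theorem isPairing_of_two_mul_card_eq (hπ : ∃ u, Setoid.ker (inputKey x u) = π)
    (hs : ∀ l, copyIndex (x l) ≠ none → ∃ l', π l l' ∧ l' ≠ l)
    (hc : 2 * (randomBlocks x π).card = (randomPositions x).card) : IsPairing x π := by
  classical
  rw [Finset.card_eq_sum_card_image (Quotient.mk π) (randomPositions x), mul_comm,
    ← smul_eq_mul, ← Finset.sum_const] at hc
  -- Equality of the sums forces equality termwise: each random block has exactly two elements, so a
  -- third one is absurd.
  have heq := (Finset.sum_eq_sum_iff_of_le fun β hβ => two_le_card_fiber hπ hs hβ).1 hc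
  intro l hl
  obtain ⟨l', h, hne⟩ := hs l hl
  refine ⟨l', hne, fun k => ⟨fun hk => ?_, ?_⟩⟩
  · by_contra hcon
    push Not at hcon
    have hthree := heq _ (Finset.mem_image_of_mem (Quotient.mk π) (mem_randomPositions.2 hl))
    have : ({l, l', k} : Finset (Fin L)) ⊆
        (randomPositions x).filter fun j => Quotient.mk π j = Quotient.mk π l := by
      intro j hj
      have hj' : π l j := by
        simp only [Finset.mem_insert, Finset.mem_singleton] at hj
        rcases hj with rfl | rfl | rfl
        · exact π.refl _
        · exact h
        · exact hk
      rw [Finset.mem_filter, mem_randomPositions, ← copyIndex_eq_of_rel hπ hj']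
      exact ⟨hl, Quotient.sound (π.symm hj')⟩
    have hle := Finset.card_le_card this
    rw [← hthree, Finset.card_eq_three.2
      ⟨l, l', k, hne.symm, fun h => hcon.1 h.symm, fun h => hcon.2 h.symm, rfl⟩] at hle
    omega
  · rintro (rfl | rfl)
    · exact π.refl _
    · exact h

open Classical in
-- A deterministic position is alone in its block, so deterministic positions correspond to the
-- coordinates that do not scale.
theorem prod_deterministic_eq (hπ : ∃ u, Setoid.ker (inputKey x u) = π) (g : Fin L → ℤ → ℝ)
    (t : Option (Quotient π) → ℤ) :
    (∏ l, if copyIndex (x l) = none then g l (blockInputs π t (some l)) else 1) =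
      ∏ v, if v ∈ scalingCoordinates x π then 1 else
        v.elim (fun _ => 0) (fun β => g β.out) (t v) := by
  rw [Fintype.prod_option]
  simp only [none_mem_scalingCoordinates, some_mem_scalingCoordinates, Option.elim_some, if_true,
    one_mul]
  rw [← Finset.prod_filter]
  have h1 : ∀ β : Quotient π, (if β ∈ randomBlocks x π then 1 else g β.out (t (some β))) =
      if β ∉ randomBlocks x π then g β.out (t (some β)) else 1 := fun β => by
    split_ifs <;> rfl
  simp only [h1]
  rw [← Finset.prod_filter]
  refine Finset.prod_bij (fun l _ => Quotient.mk π l) (fun l hl => ?_) (fun l hl l' _ h => ?_)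
    (fun β hβ => ?_) (fun l hl => ?_)
  · have := (Finset.mem_filter.1 hl).2
    simp [mk_mem_randomBlocks hπ, this]
  · exact eq_of_rel_of_copyIndex_eq_none hπ (Quotient.exact h) (Finset.mem_filter.1 hl).2
  · refine ⟨β.out, ?_, β.out_eq⟩
    have := (Finset.mem_filter.1 hβ).2
    rw [← β.out_eq, mk_mem_randomBlocks hπ, not_not] at this
    simpa using this
  · have : l = (Quotient.mk π l).out := eq_of_rel_of_copyIndex_eq_none hπ
      (π.symm (Quotient.mk_out l)) (Finset.mem_filter.1 hl).2
    rw [← this]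
    rfl

theorem prod_latticeScale (n : ℕ) [Fintype (Quotient π)] :
    ∏ v, latticeScale (scalingCoordinates x π) n v = (n : ℝ) * (n : ℝ) ^ (randomBlocks x π).card := by
  classical
  rw [Fintype.prod_option]
  simp only [latticeScale, none_mem_scalingCoordinates, some_mem_scalingCoordinates, if_true]
  rw [← Finset.prod_filter, Finset.prod_const]
  congr 3
  ext β
  simp

/-- Each step adds or subtracts a coordinate, or reflects in `n - 1` as well. Validity, closure and
sides of a path thus become comparisons of integer affine functions. -/
theorem isIntAffine_latticePath [Fintype (Quotient π)] (l : ℕ) :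
    IsIntAffine fun n (t : Option (Quotient π) → ℤ) => latticePath n x (blockInputs π t) l := by
  classical
  induction l with
  | zero => exact .coord none
  | succ l ih =>
    simp only [latticePath]
    split
    · rename_i h
      have hc : IsIntAffine fun (_ : ℕ) (t : Option (Quotient π) → ℤ) =>
        blockInputs π t (some ⟨l, h⟩) := .coord _
      obtain ⟨_ | _ | _, _ | _⟩ := x ⟨l, h⟩
      · exact ((IsIntAffine.size.sub (.const 1)).sub ih).sub hc
      · exact ((IsIntAffine.size.sub (.const 1)).sub ih).sub hc
      · exact ih.sub hc
      · exact ih.add hc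
      · exact ih.sub hc
      · exact ih.add hc
    · exact .const 0

end Blocks

theorem norm_pathWeight_le (x : Fin L → MatrixLabel m × Bool) (W : Fin L → Bool → ℤ → ℂ)
    (g : Fin L → ℤ → ℝ) (Φ : ℕ → (Fin L → ℤ) → (Fin L → Bool) → ℂ) (K : ℝ) (hg0 : ∀ l k, 0 ≤ g l k)
    (hW : ∀ l s k, copyIndex (x l) = none → ‖W l s k‖ ≤ g l k)
    (hW1 : ∀ l s k, copyIndex (x l) ≠ none → W l s k = 1)
    (hK : ∀ n, 1 ≤ n → ∀ u s, ‖Φ n u s‖ ≤ K) {n : ℕ} (hn : 1 ≤ n) (y : Option (Fin L) → ℤ) :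
    ‖pathWeight x W Φ n y‖ ≤
      K * ∏ l, if copyIndex (x l) = none then g l (y (some l)) else 1 := by
  have hK0 : 0 ≤ K := (norm_nonneg _).trans (hK n hn 0 fun _ => true)
  have hprod : 0 ≤ ∏ l, if copyIndex (x l) = none then g l (y (some l)) else 1 :=
    Finset.prod_nonneg fun l _ => by
      split
      · exact hg0 _ _
      · exact zero_le_one
  unfold pathWeight
  split
  · rw [norm_mul, mul_comm, norm_prod]
    refine mul_le_mul (hK n hn _ _) ?_ (by positivity) hK0
    refine Finset.prod_le_prod (fun _ _ => norm_nonneg _) fun l _ => ?_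
    split
    · exact hW _ _ _ ‹_›
    · rw [hW1 _ _ _ ‹_›, norm_one]
  · rw [norm_zero]
    positivity

end Asymptotics

/-! ### The limit for one pattern of coinciding inputs -/

section BlockAsymptotics

variable {m L : ℕ}

/-- The power of `n` by which the number of blocks deviates from the normalization. -/
noncomputable def blockFactor (b r : ℕ) (n : ℕ) : ℝ := (n : ℝ) ^ b * ((√n)⁻¹) ^ r

theorem blockFactor_eq {b r : ℕ} (h : 2 * b ≤ r) {n : ℕ} (hn : 1 ≤ n) :
    blockFactor b r n = ((√n)⁻¹) ^ (r - 2 * b) := by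
  have hpos : (0 : ℝ) < √n := Real.sqrt_pos.2 (by exact_mod_cast hn)
  obtain ⟨k, rfl⟩ := Nat.exists_eq_add_of_le h
  have hsq : (n : ℝ) = √n ^ 2 := (Real.sq_sqrt (Nat.cast_nonneg n)).symm
  rw [blockFactor, Nat.add_sub_cancel_left, pow_add, ← mul_assoc]
  nth_rewrite 1 [hsq]
  rw [← pow_mul, ← mul_pow, mul_inv_cancel₀ hpos.ne', one_pow, one_mul]

theorem tendsto_blockFactor {b r : ℕ} (h : 2 * b < r) :
    Tendsto (blockFactor b r) atTop (𝓝 0) := by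
  have h1 : Tendsto (fun n : ℕ => (√(n : ℝ))⁻¹) atTop (𝓝 0) :=
    tendsto_inv_atTop_zero.comp (Real.tendsto_sqrt_atTop.comp tendsto_natCast_atTop_atTop)
  have h2 := h1.pow (r - 2 * b)
  rw [zero_pow (by omega)] at h2
  refine h2.congr' ?_
  filter_upwards [eventually_ge_atTop 1] with n hn
  exact (blockFactor_eq h.le hn).symm

theorem blockFactor_nonneg (b r n : ℕ) : 0 ≤ blockFactor b r n := by
  unfold blockFactor
  positivity

theorem blockFactor_le_one {b r : ℕ} (h : 2 * b ≤ r) {n : ℕ} (hn : 1 ≤ n) :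
    blockFactor b r n ≤ 1 := by
  rw [blockFactor_eq h hn]
  refine pow_le_one₀ (by positivity) (inv_le_one_of_one_le₀ ?_)
  rw [Real.one_le_sqrt]
  exact_mod_cast hn

/-! ### Stabilization of the conditions on a path -/

section Decided

variable {x : Fin L → MatrixLabel m × Bool} {π : Setoid (Fin L)} [Fintype (Quotient π)]
  {S : Set (Option (Quotient π))} {X : Option (Quotient π) → ℝ}

theorem eventuallyDecided_le {V : Type*} [Fintype V] {S : Set V} {X : V → ℝ}
    (hX : ∀ f : ℕ → (V → ℤ) → ℤ, IsIntAffine f →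
      EventuallyDecided fun n => 0 ≤ f n (latticePoint S n X))
    {f g : ℕ → (V → ℤ) → ℤ} (hf : IsIntAffine f) (hg : IsIntAffine g) :
    EventuallyDecided fun n => f n (latticePoint S n X) ≤ g n (latticePoint S n X) :=
  (hX _ (hg.sub hf)).congr fun _ => sub_nonneg

theorem eventuallyDecided_eq {V : Type*} [Fintype V] {S : Set V} {X : V → ℝ}
    (hX : ∀ f : ℕ → (V → ℤ) → ℤ, IsIntAffine f →
      EventuallyDecided fun n => 0 ≤ f n (latticePoint S n X))
    {f g : ℕ → (V → ℤ) → ℤ} (hf : IsIntAffine f) (hg : IsIntAffine g) :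
    EventuallyDecided fun n => f n (latticePoint S n X) = g n (latticePoint S n X) :=
  ((eventuallyDecided_le hX hf hg).and (eventuallyDecided_le hX hg hf)).congr
    fun _ => le_antisymm_iff.symm

theorem eventuallyDecided_mem_latticeBox [DecidableEq (Option (Quotient π))]
    (hX : ∀ f : ℕ → (Option (Quotient π) → ℤ) → ℤ, IsIntAffine f →
      EventuallyDecided fun n => 0 ≤ f n (latticePoint S n X)) :
    EventuallyDecided fun n => latticePoint S n X ∈ latticeBox (Option (Quotient π)) n := by
  have h : ∀ v, EventuallyDecided fun n : ℕ =>
      -(n : ℤ) ≤ latticePoint S n X v ∧ latticePoint S n X v ≤ n := fun v =>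
    (eventuallyDecided_le hX IsIntAffine.size.neg (.coord v)).and
      (eventuallyDecided_le hX (.coord v) IsIntAffine.size)
  refine (EventuallyDecided.all h).congr fun n => ?_
  simp [latticeBox, Fintype.mem_piFinset]

theorem eventuallyDecided_ker_eq
    (hX : ∀ f : ℕ → (Option (Quotient π) → ℤ) → ℤ, IsIntAffine f →
      EventuallyDecided fun n => 0 ≤ f n (latticePoint S n X)) :
    EventuallyDecided fun n =>
    Setoid.ker (inputKey x fun l => blockInputs π (latticePoint S n X) (some l)) = π := by
  classical
  have h : ∀ l l', EventuallyDecided fun n =>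
      Setoid.ker (inputKey x fun l => blockInputs π (latticePoint S n X) (some l)) l l' ↔
        π l l' := by
    intro l l'
    refine EventuallyDecided.iff_const ?_ _
    refine EventuallyDecided.congr ?_ fun n => (inputKey_eq_iff x _ l l').symm
    refine (EventuallyDecided.const _).or ((EventuallyDecided.const _).and
      ((EventuallyDecided.const _).and ?_))
    exact eventuallyDecided_eq hX (.coord (some (Quotient.mk π l)))
      (.coord (some (Quotient.mk π l')))
  refine (EventuallyDecided.all fun l => EventuallyDecided.all (h l)).congr fun n => ?_
  exact Setoid.ext_iff.symm

theorem eventuallyDecided_isValidPath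
    (hX : ∀ f : ℕ → (Option (Quotient π) → ℤ) → ℤ, IsIntAffine f →
      EventuallyDecided fun n => 0 ≤ f n (latticePoint S n X)) :
    EventuallyDecided fun n =>
    IsValidPath n x (blockInputs π (latticePoint S n X)) ∧
      latticePath n x (blockInputs π (latticePoint S n X)) 0 =
        latticePath n x (blockInputs π (latticePoint S n X)) L := by
  refine EventuallyDecided.and (EventuallyDecided.all fun l => .and ?_ ?_) ?_
  · exact eventuallyDecided_le hX (.const 0) (isIntAffine_latticePath l)
  · refine (eventuallyDecided_le hX IsIntAffine.size
      (isIntAffine_latticePath l)).not.congr fun n => not_le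
  · exact eventuallyDecided_eq hX (isIntAffine_latticePath 0) (isIntAffine_latticePath L)

theorem exists_eventually_pathSide_eq
    (hX : ∀ f : ℕ → (Option (Quotient π) → ℤ) → ℤ, IsIntAffine f →
      EventuallyDecided fun n => 0 ≤ f n (latticePoint S n X)) :
    ∃ s : Fin L → Bool, ∀ᶠ n in atTop,
    pathSide n x (blockInputs π (latticePoint S n X)) = s := by
  classical
  have h : ∀ l : Fin L, EventuallyDecided fun n : ℕ =>
      latticePath n x (blockInputs π (latticePoint S n X)) l +
        latticePath n x (blockInputs π (latticePoint S n X)) (l + 1) + 2 ≤ n := fun l =>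
    eventuallyDecided_le hX (((isIntAffine_latticePath l).add
      (isIntAffine_latticePath (l + 1))).add (.const 2)) IsIntAffine.size
  choose p hp using fun l => (h l).eventually_iff
  refine ⟨fun l => decide (p l), ?_⟩
  filter_upwards [eventually_all.2 hp] with n hn
  funext l
  simp only [pathSide, hn l]

end Decided

variable (x : Fin L → MatrixLabel m × Bool) (W : Fin L → Bool → ℤ → ℂ)
  (g : Fin L → ℤ → ℝ) (Φ : ℕ → (Fin L → ℤ) → (Fin L → Bool) → ℂ) (K : ℝ)

open Classical in
/-- The contribution of the paths with a given pattern of coinciding random inputs converges. -/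
theorem exists_tendsto_sum_block (hg : ∀ l, Summable (g l)) (hg0 : ∀ l k, 0 ≤ g l k)
    (hW : ∀ l s k, copyIndex (x l) = none → ‖W l s k‖ ≤ g l k)
    (hW1 : ∀ l s k, copyIndex (x l) ≠ none → W l s k = 1)
    (hK : ∀ n, 1 ≤ n → ∀ u s, ‖Φ n u s‖ ≤ K)
    (hsing : ∀ n, 1 ≤ n → ∀ u s l, copyIndex (x l) ≠ none →
      (∀ l', inputKey x u l = inputKey x u l' → l' = l) → Φ n u s = 0)
    (hpair : ∀ π, IsPairing x π → ∃ ψ : (Fin L → Bool) → ℂ, ∀ n, 1 ≤ n → ∀ u s,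
      Setoid.ker (inputKey x u) = π → Φ n u s = ψ s)
    (π : Setoid (Fin L)) :
    ∃ c, Tendsto (fun n : ℕ => (n : ℂ)⁻¹ * (((√n)⁻¹ : ℝ) : ℂ) ^ (randomPositions x).card *
      ∑ t ∈ latticeBox (Option (Quotient π)) n,
        if Setoid.ker (inputKey x fun l => blockInputs π t (some l)) = π then
          pathWeight x W Φ n (blockInputs π t) else 0) atTop (𝓝 c) := by
  by_cases hπ : ∃ u, Setoid.ker (inputKey x u) = π
  swap
  · refine ⟨0, tendsto_const_nhds.congr fun n => ?_⟩
    rw [Finset.sum_eq_zero, mul_zero]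
    exact fun t _ => if_neg fun h => hπ ⟨_, h⟩
  -- A random position alone in its block makes every expectation vanish by `hsing`.
  by_cases hs : ∀ l, copyIndex (x l) ≠ none → ∃ l', π l l' ∧ l' ≠ l
  swap
  · push Not at hs
    obtain ⟨l, hl, hl'⟩ := hs
    refine ⟨0, tendsto_const_nhds.congr' ?_⟩
    filter_upwards [eventually_ge_atTop 1] with n hn
    rw [Finset.sum_eq_zero, mul_zero]
    intro t _
    split
    · rename_i hker
      unfold pathWeight
      rw [hsing n hn _ _ l hl, mul_zero, ite_self]
      intro l' h
      refine hl' l' ?_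
      rw [← hker]
      exact h
    · rfl
  set S := scalingCoordinates x π with hS
  set b := (randomBlocks x π).card
  set r := (randomPositions x).card
  have hbr : 2 * b ≤ r := two_mul_card_randomBlocks_le hπ hs
  -- The cutoff provides the vanishing outside the box that `exists_tendsto_sum_latticeBox` asks
  -- for.
  let E : ℕ → (Option (Quotient π) → ℤ) → ℂ := fun n t =>
    if t ∈ latticeBox (Option (Quotient π)) n then
      if Setoid.ker (inputKey x fun l => blockInputs π t (some l)) = π then
        pathWeight x W Φ n (blockInputs π t) else 0
    else 0
  -- The value at `none` is immaterial, since `none` is a scaling coordinate.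
  let g' : Option (Quotient π) → ℤ → ℝ := fun v => v.elim (fun _ => 0) fun β => g β.out
  have hg'0 : ∀ v k, 0 ≤ g' v k := by
    rintro (_ | β) k
    · exact le_rfl
    · exact hg0 _ _
  have hE : ∀ n, 1 ≤ n → ∀ t, ‖E n t‖ ≤ K * ∏ v, if v ∈ S then 1 else g' v (t v) := by
    intro n hn t
    have hK0 : 0 ≤ K := (norm_nonneg _).trans (hK n hn 0 fun _ => true)
    have h0 : 0 ≤ K * ∏ v, if v ∈ S then 1 else g' v (t v) :=
      mul_nonneg hK0 (Finset.prod_nonneg fun v _ => by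
        split
        · exact zero_le_one
        · exact hg'0 _ _)
    simp only [E]
    split_ifs
    · refine (norm_pathWeight_le x W g Φ K hg0 hW hW1 hK hn _).trans_eq ?_
      rw [prod_deterministic_eq hπ g t]
    · rwa [norm_zero]
    · rwa [norm_zero]
  have hmain := exists_tendsto_sum_latticeBox S
    (fun n t => (blockFactor b r n : ℂ) * E n t) g' ?_ hg'0 K ?_ ?_ ?_
  · obtain ⟨c, hc⟩ := hmain
    refine ⟨c, hc.congr' ?_⟩
    filter_upwards [eventually_ge_atTop 1] with n hn
    have hn0 : (n : ℂ) ≠ 0 := by exact_mod_cast (by omega : n ≠ 0)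
    rw [prod_latticeScale, ← Finset.mul_sum, ← mul_assoc]
    congr 1
    · simp only [blockFactor]
      push_cast
      field_simp
      rfl
    · exact Finset.sum_congr rfl fun t ht => by simp [E, ht]
  · rintro (_ | β)
    · exact summable_zero
    · exact hg _
  · intro n u hu
    simp [E, hu]
  · intro n hn t
    rw [norm_mul, Complex.norm_real, Real.norm_of_nonneg (blockFactor_nonneg _ _ _)]
    exact (mul_le_of_le_one_left (norm_nonneg _) (blockFactor_le_one hbr hn)).trans (hE n hn t)
  · filter_upwards [ae_forall_eventuallyDecided_nonneg S] with X hX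
    have hfix : ∀ v, v ∉ S → ∀ n, latticePoint S n X v = ⌊X v⌋ := by
      intro v hv n
      simp [latticePoint, latticeScale, hv]
    -- With too few blocks, `blockFactor` tends to `0` against a bound that does not depend on `n`,
    -- since the other coordinates are fixed at `⌊X v⌋`. With `2 * b = r`, the factor is `1` and the
    -- integrand is eventually constant.
    rcases hbr.lt_or_eq with hlt | heq
    · refine ⟨0, ?_⟩
      have hbd := (tendsto_blockFactor hlt).mul_const
        (K * ∏ v, if v ∈ S then 1 else g' v ⌊X v⌋)
      rw [zero_mul] at hbd
      refine squeeze_zero_norm' ?_ hbd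
      filter_upwards [eventually_ge_atTop 1] with n hn
      rw [norm_mul, Complex.norm_real, Real.norm_of_nonneg (blockFactor_nonneg _ _ _)]
      refine mul_le_mul_of_nonneg_left ((hE n hn _).trans_eq ?_) (blockFactor_nonneg _ _ _)
      congr 1
      refine Finset.prod_congr rfl fun v _ => ?_
      split
      · rfl
      · rw [hfix v ‹_›]
    · obtain ⟨ψ, hψ⟩ := hpair π (isPairing_of_two_mul_card_eq hπ hs heq)
      obtain ⟨s, hside⟩ := exists_eventually_pathSide_eq (x := x) hX
      obtain ⟨p, hp⟩ := (eventuallyDecided_mem_latticeBox hX).eventually_iff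
      obtain ⟨q, hq⟩ := (eventuallyDecided_ker_eq (x := x) hX).eventually_iff
      obtain ⟨v, hv⟩ := (eventuallyDecided_isValidPath (x := x) hX).eventually_iff
      refine ⟨if p then if q then if v then
        (∏ l, W l (s l) ⌊X (some (Quotient.mk π l))⌋) * ψ s else 0 else 0 else 0, ?_⟩
      refine tendsto_const_nhds.congr' ?_
      filter_upwards [eventually_ge_atTop 1, hside, hp, hq, hv] with n hn hside hp hq hv
      rw [blockFactor_eq hbr hn, heq, Nat.sub_self, pow_zero, Complex.ofReal_one, one_mul]
      simp only [E, pathWeight, hp, hq, hv, hside]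
      by_cases hq' : q
      · simp only [hq', if_true]
        congr 3
        · refine Finset.prod_congr rfl fun l _ => ?_
          -- A deterministic input does not move with `n`; a random letter has weight `1` wherever
          -- it is read.
          by_cases hl : copyIndex (x l) = none
          · congr 1
            refine (hfix _ ?_ n).symm
            simp [hS, some_mem_scalingCoordinates, mk_mem_randomBlocks hπ, hl]
          · rw [hW1 l _ _ hl, hW1 l _ _ hl]
        · exact (hψ n hn _ _ (hq.2 hq')).symm
      · simp [hq']

/-- Sums over closed paths converge, if the expectations `Φ` of the products of the random inputs
are bounded, vanish when some random input occurs only once, and do not depend on the inputs when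
every random input occurs exactly twice. -/
theorem exists_tendsto_sum_pathWeight (hg : ∀ l, Summable (g l)) (hg0 : ∀ l k, 0 ≤ g l k)
    (hW : ∀ l s k, copyIndex (x l) = none → ‖W l s k‖ ≤ g l k)
    (hW1 : ∀ l s k, copyIndex (x l) ≠ none → W l s k = 1)
    (hK : ∀ n, 1 ≤ n → ∀ u s, ‖Φ n u s‖ ≤ K)
    (hsing : ∀ n, 1 ≤ n → ∀ u s l, copyIndex (x l) ≠ none →
      (∀ l', inputKey x u l = inputKey x u l' → l' = l) → Φ n u s = 0)
    (hpair : ∀ π, IsPairing x π → ∃ ψ : (Fin L → Bool) → ℂ, ∀ n, 1 ≤ n → ∀ u s,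
      Setoid.ker (inputKey x u) = π → Φ n u s = ψ s) :
    ∃ c, Tendsto (fun n : ℕ => (n : ℂ)⁻¹ * (((√n)⁻¹ : ℝ) : ℂ) ^ (randomPositions x).card *
      ∑ y ∈ latticeBox (Option (Fin L)) n, pathWeight x W Φ n y) atTop (𝓝 c) := by
  classical
  have : Fintype (Setoid (Fin L)) := Fintype.ofFinite _
  choose c hc using exists_tendsto_sum_block x W g Φ K hg hg0 hW hW1 hK hsing hpair
  refine ⟨∑ π, c π, (tendsto_finsetSum Finset.univ fun π _ => hc π).congr fun n => ?_⟩
  rw [← Finset.mul_sum]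
  congr 1
  convert (sum_latticeBox_eq_sum_setoid n x (pathWeight x W Φ n)).symm

end BlockAsymptotics

/-! ### Moments of the random inputs -/

/-- The factor that a random letter contributes: the first input on the side `true` and the second
one on the side `false`, conjugated if `ε` holds. -/
noncomputable def inputValue (ε s : Bool) (z : ℂ × ℂ) : ℂ :=
  if ε then star (if s then z.1 else z.2) else if s then z.1 else z.2

theorem measurable_inputValue (ε s : Bool) : Measurable (inputValue ε s) := by
  unfold inputValue
  cases ε <;> cases s <;> simp only [if_true, Bool.false_eq_true, if_false] <;> fun_prop

theorem norm_inputValue (ε s : Bool) (z : ℂ × ℂ) :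
    ‖inputValue ε s z‖ = ‖if s then z.1 else z.2‖ := by
  cases ε <;> simp [inputValue]

namespace InputAssumption

variable {Ω : Type*} [MeasurableSpace Ω] {μ : Measure Ω}
  {v : Fin 4 → ℝ} {ρ : Fin 6 → ℝ} {c : ℕ → ℝ} {a b : ℤ → Ω → ℂ}

theorem hasAllMoments_of_re_im {f : Ω → ℂ} (hf : Measurable f)
    (hre : ∀ k ≥ 1, Integrable (fun ω => |(f ω).re| ^ k) μ)
    (him : ∀ k ≥ 1, Integrable (fun ω => |(f ω).im| ^ k) μ) : HasAllMoments μ f := by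
  intro k
  rcases Nat.eq_zero_or_pos k with rfl | hk
  · simpa using hf.aestronglyMeasurable
  · have h0 : (k : ENNReal) ≠ 0 := by exact_mod_cast hk.ne'
    refine memLp_re_im_iff.1 ⟨?_, ?_⟩
    · refine (integrable_norm_rpow_iff
        (Complex.measurable_re.comp hf).aestronglyMeasurable h0 (by simp)).1 ?_
      simpa using hre k hk
    · refine (integrable_norm_rpow_iff
        (Complex.measurable_im.comp hf).aestronglyMeasurable h0 (by simp)).1 ?_
      simpa using him k hk

theorem hasAllMoments_a (h : InputAssumption μ v ρ c a b) (j : ℤ) : HasAllMoments μ (a j) :=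
  hasAllMoments_of_re_im (h.measurable_a j) (fun k hk => (h.moment_x j k hk).1)
    fun k hk => (h.moment_y j k hk).1

theorem hasAllMoments_b (h : InputAssumption μ v ρ c a b) (j : ℤ) : HasAllMoments μ (b j) :=
  hasAllMoments_of_re_im (h.measurable_b j) (fun k hk => (h.moment_x' j k hk).1)
    fun k hk => (h.moment_y' j k hk).1

theorem hasAllMoments_inputValue (h : InputAssumption μ v ρ c a b) (ε s : Bool) (j : ℤ) :
    HasAllMoments μ fun ω => inputValue ε s (a j ω, b j ω) := by
  cases ε <;> cases s <;> simp only [inputValue, if_true, Bool.false_eq_true, if_false]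
  · exact h.hasAllMoments_b j
  · exact h.hasAllMoments_a j
  · exact (h.hasAllMoments_b j).star
  · exact (h.hasAllMoments_a j).star

theorem integral_inputValue (h : InputAssumption μ v ρ c a b) (ε s : Bool) (j : ℤ) :
    ∫ ω, inputValue ε s (a j ω, b j ω) ∂μ = 0 := by
  have hstar : ∀ f : Ω → ℂ, ∫ ω, star (f ω) ∂μ = star (∫ ω, f ω ∂μ) := fun f => integral_conj
  cases ε <;> cases s <;> simp only [inputValue, if_true, Bool.false_eq_true, if_false]
  · exact h.mean_b j
  · exact h.mean_a j
  · rw [hstar, h.mean_b j, star_zero]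
  · rw [hstar, h.mean_a j, star_zero]

theorem integral_norm_pow_le [IsFiniteMeasure μ] {f : Ω → ℂ} (hf : HasAllMoments μ f) {k : ℕ} {C : ℝ}
    (hre : Integrable (fun ω => |(f ω).re| ^ k) μ ∧ ∫ ω, |(f ω).re| ^ k ∂μ ≤ C)
    (him : Integrable (fun ω => |(f ω).im| ^ k) μ ∧ ∫ ω, |(f ω).im| ^ k ∂μ ≤ C) :
    ∫ ω, ‖f ω‖ ^ k ∂μ ≤ 2 ^ (k - 1) * (C + C) := by
  calc ∫ ω, ‖f ω‖ ^ k ∂μ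
      ≤ ∫ ω, 2 ^ (k - 1) * (|(f ω).re| ^ k + |(f ω).im| ^ k) ∂μ := by
        refine integral_mono (hf k).integrable_norm_pow' ((hre.1.add him.1).const_mul _) fun ω => ?_
        exact (pow_le_pow_left₀ (norm_nonneg _) (Complex.norm_le_abs_re_add_abs_im _) k).trans
          (add_pow_le (abs_nonneg _) (abs_nonneg _) k)
    _ = 2 ^ (k - 1) * (∫ ω, |(f ω).re| ^ k ∂μ + ∫ ω, |(f ω).im| ^ k ∂μ) := by
        rw [integral_const_mul, integral_add hre.1 him.1]
    _ ≤ _ := by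
        gcongr
        · exact hre.2
        · exact him.2

theorem integral_norm_inputValue_pow_le [IsFiniteMeasure μ] (h : InputAssumption μ v ρ c a b) (ε s : Bool) (j : ℤ)
    {k : ℕ} (hk : 1 ≤ k) :
    ∫ ω, ‖inputValue ε s (a j ω, b j ω)‖ ^ k ∂μ ≤ 2 ^ (k - 1) * (c k + c k) := by
  simp only [norm_inputValue]
  cases s
  · exact integral_norm_pow_le (h.hasAllMoments_b j) (h.moment_x' j k hk) (h.moment_y' j k hk)
  · exact integral_norm_pow_le (h.hasAllMoments_a j) (h.moment_x j k hk) (h.moment_y j k hk)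

end InputAssumption

/-- The product is at most a power of its largest factor, which is one of the summands; the `1`
covers the empty product. -/
theorem Finset.prod_le_one_add_sum_pow_card {κ : Type*} (T : Finset κ) (f : κ → ℝ)
    (hf : ∀ i, 0 ≤ f i) : ∏ i ∈ T, f i ≤ 1 + ∑ i ∈ T, f i ^ T.card := by
  rcases T.eq_empty_or_nonempty with rfl | hT
  · simp
  · obtain ⟨k, hk, hmax⟩ := T.exists_max_image f hT
    calc ∏ i ∈ T, f i ≤ ∏ _i ∈ T, f k := Finset.prod_le_prod (fun i _ => hf i) hmax
      _ = f k ^ T.card := by rw [Finset.prod_const]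
      _ ≤ ∑ i ∈ T, f i ^ T.card :=
        Finset.single_le_sum (f := fun i => f i ^ T.card) (fun i _ => pow_nonneg (hf i) _) hk
      _ ≤ _ := by linarith

/-- A bound for the expectations of products of at most `L` random inputs. -/
noncomputable def momentBound (c : ℕ → ℝ) (L : ℕ) : ℝ :=
  -- The sum runs over all possible numbers of factors. The absolute values keep the summands
  -- nonnegative, `c 0` being unconstrained.
  1 + ∑ k ∈ Finset.range (L + 1), (L : ℝ) * (2 ^ (k - 1) * (|c k| + |c k|))

theorem InputAssumption.norm_integral_prod_le {Ω : Type*} [MeasurableSpace Ω] {μ : Measure Ω}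
    [IsProbabilityMeasure μ] {v : Fin 4 → ℝ} {ρ : Fin 6 → ℝ} {c : ℕ → ℝ} {a b : ℤ → Ω → ℂ}
    (h : InputAssumption μ v ρ c a b) {L : ℕ} (T : Finset (Fin L)) (ε s : Fin L → Bool)
    (u : Fin L → ℤ) :
    ‖∫ ω, ∏ l ∈ T, inputValue (ε l) (s l) (a (u l) ω, b (u l) ω) ∂μ‖ ≤ momentBound c L := by
  have hmom := fun l => h.hasAllMoments_inputValue (ε l) (s l) (u l)
  have hint : ∀ l ∈ T, Integrable
      (fun ω => ‖inputValue (ε l) (s l) (a (u l) ω, b (u l) ω)‖ ^ T.card) μ :=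
    fun l _ => (hmom l T.card).integrable_norm_pow'
  calc ‖∫ ω, ∏ l ∈ T, inputValue (ε l) (s l) (a (u l) ω, b (u l) ω) ∂μ‖
      ≤ ∫ ω, ‖∏ l ∈ T, inputValue (ε l) (s l) (a (u l) ω, b (u l) ω)‖ ∂μ :=
        norm_integral_le_integral_norm _
    _ ≤ ∫ ω, (1 + ∑ l ∈ T, ‖inputValue (ε l) (s l) (a (u l) ω, b (u l) ω)‖ ^ T.card) ∂μ := by
        refine integral_mono ?_ ((integrable_const _).add (integrable_finsetSum _ hint))
          fun ω => ?_
        · exact (HasAllMoments.prod T fun l _ => hmom l).integrable.norm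
        · simp only [norm_prod]
          exact Finset.prod_le_one_add_sum_pow_card _ _ fun _ => norm_nonneg _
    _ = 1 + ∑ l ∈ T, ∫ ω, ‖inputValue (ε l) (s l) (a (u l) ω, b (u l) ω)‖ ^ T.card ∂μ := by
        rw [integral_add (integrable_const _) (integrable_finsetSum _ hint),
          integral_finsetSum _ hint]
        simp
    _ ≤ 1 + (L : ℝ) * (2 ^ (T.card - 1) * (|c T.card| + |c T.card|)) := by
        gcongr
        calc ∑ l ∈ T, ∫ ω, ‖inputValue (ε l) (s l) (a (u l) ω, b (u l) ω)‖ ^ T.card ∂μ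
            ≤ ∑ _l ∈ T, 2 ^ (T.card - 1) * (|c T.card| + |c T.card|) := by
              refine Finset.sum_le_sum fun l hl => ?_
              refine (h.integral_norm_inputValue_pow_le _ _ _
                (Finset.card_pos.2 ⟨l, hl⟩)).trans ?_
              gcongr <;> exact le_abs_self _
          _ = (T.card : ℝ) * (2 ^ (T.card - 1) * (|c T.card| + |c T.card|)) := by
              rw [Finset.sum_const, nsmul_eq_mul]
          _ ≤ _ := by
              gcongr
              exact (Finset.card_le_univ T).trans_eq (Fintype.card_fin L)
    _ ≤ momentBound c L := by
        rw [momentBound]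
        gcongr
        refine Finset.single_le_sum (f := fun k =>
          (L : ℝ) * (2 ^ (k - 1) * (|c k| + |c k|))) (fun k _ => by positivity) ?_
        rw [Finset.mem_range, Nat.lt_succ_iff]
        exact (Finset.card_le_univ T).trans_eq (Fintype.card_fin L)

/-! ### Second moments of the inputs -/

section Covariance

/-- The real (`q = true`) or imaginary part of the input on the side `s`. -/
def inputPart (s q : Bool) (z : ℂ × ℂ) : ℝ :=
  if q then (if s then z.1 else z.2).re else (if s then z.1 else z.2).im

theorem inputValue_eq (ε s : Bool) (z : ℂ × ℂ) : inputValue ε s z =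
    (inputPart s true z : ℂ) + (if ε then -Complex.I else Complex.I) * inputPart s false z := by
  cases ε <;> cases s <;> simp [inputValue, inputPart, Complex.ext_iff]

/-- The sixteen cases are the prescribed second and mixed moments, up to the order of the factors.
Choosing `r` before the probability space makes it independent of `n`. -/
theorem exists_integral_inputPart_mul (v : Fin 4 → ℝ) (ρ : Fin 6 → ℝ) (c : ℕ → ℝ)
    (s q s' q' : Bool) : ∃ r : ℝ, ∀ {Ω : Type*} [MeasurableSpace Ω] (μ : Measure Ω) (a b : ℤ → Ω → ℂ),
      InputAssumption μ v ρ c a b → ∀ j,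
        ∫ ω, inputPart s q (a j ω, b j ω) * inputPart s' q' (a j ω, b j ω) ∂μ = r := by
  cases s <;> cases q <;> cases s' <;> cases q' <;>
    simp only [inputPart, if_true, Bool.false_eq_true, if_false, ← sq]
  · exact ⟨_, fun _ _ _ h j => h.sq_y' j⟩
  · exact ⟨_, fun _ _ _ h j => (integral_congr_ae (.of_forall fun _ => mul_comm _ _)).trans
      (h.corr_x'_y' j)⟩
  · exact ⟨_, fun _ _ _ h j => (integral_congr_ae (.of_forall fun _ => mul_comm _ _)).trans
      (h.corr_y_y' j)⟩
  · exact ⟨_, fun _ _ _ h j => (integral_congr_ae (.of_forall fun _ => mul_comm _ _)).trans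
      (h.corr_x_y' j)⟩
  · exact ⟨_, fun _ _ _ h j => h.corr_x'_y' j⟩
  · exact ⟨_, fun _ _ _ h j => h.sq_x' j⟩
  · exact ⟨_, fun _ _ _ h j => h.corr_x'_y j⟩
  · exact ⟨_, fun _ _ _ h j => (integral_congr_ae (.of_forall fun _ => mul_comm _ _)).trans
      (h.corr_x_x' j)⟩
  · exact ⟨_, fun _ _ _ h j => h.corr_y_y' j⟩
  · exact ⟨_, fun _ _ _ h j => (integral_congr_ae (.of_forall fun _ => mul_comm _ _)).trans
      (h.corr_x'_y j)⟩
  · exact ⟨_, fun _ _ _ h j => h.sq_y j⟩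
  · exact ⟨_, fun _ _ _ h j => (integral_congr_ae (.of_forall fun _ => mul_comm _ _)).trans
      (h.corr_x_y j)⟩
  · exact ⟨_, fun _ _ _ h j => h.corr_x_y' j⟩
  · exact ⟨_, fun _ _ _ h j => h.corr_x_x' j⟩
  · exact ⟨_, fun _ _ _ h j => h.corr_x_y j⟩
  · exact ⟨_, fun _ _ _ h j => h.sq_x j⟩

theorem InputAssumption.hasAllMoments_inputPart {Ω : Type*} [MeasurableSpace Ω] {μ : Measure Ω}
    [IsProbabilityMeasure μ] {v : Fin 4 → ℝ} {ρ : Fin 6 → ℝ} {c : ℕ → ℝ} {a b : ℤ → Ω → ℂ}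
    (h : InputAssumption μ v ρ c a b) (s q : Bool) (j : ℤ) :
    HasAllMoments μ fun ω => (inputPart s q (a j ω, b j ω) : ℂ) := by
  intro k
  cases q <;> cases s <;> simp only [inputPart, if_true, Bool.false_eq_true, if_false]
  · exact (h.hasAllMoments_b j k).im.ofReal
  · exact (h.hasAllMoments_a j k).im.ofReal
  · exact (h.hasAllMoments_b j k).re.ofReal
  · exact (h.hasAllMoments_a j k).re.ofReal

/-- The expectations of products of two random inputs with the same index do not depend on the
index and on the probability space. -/
theorem exists_integral_inputValue_mul (v : Fin 4 → ℝ) (ρ : Fin 6 → ℝ) (c : ℕ → ℝ)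
    (ε s ε' s' : Bool) : ∃ r : ℂ, ∀ {Ω : Type*} [MeasurableSpace Ω] (μ : Measure Ω)
      [IsProbabilityMeasure μ] (a b : ℤ → Ω → ℂ), InputAssumption μ v ρ c a b → ∀ j,
        ∫ ω, inputValue ε s (a j ω, b j ω) * inputValue ε' s' (a j ω, b j ω) ∂μ = r := by
  choose R hR using exists_integral_inputPart_mul v ρ c
  refine ⟨R s true s' true + (if ε' then -Complex.I else Complex.I) * R s true s' false +
    (if ε then -Complex.I else Complex.I) * R s false s' true +
    (if ε then -Complex.I else Complex.I) * (if ε' then -Complex.I else Complex.I) *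
      R s false s' false, ?_⟩
  intro Ω _ μ _ a b h j
  have hint : ∀ q q', Integrable (fun ω => (inputPart s q (a j ω, b j ω) : ℂ) *
      inputPart s' q' (a j ω, b j ω)) μ := fun q q' =>
    ((h.hasAllMoments_inputPart s q j).mul (h.hasAllMoments_inputPart s' q' j)).integrable
  have hval : ∀ q q', ∫ ω, (inputPart s q (a j ω, b j ω) : ℂ) *
      inputPart s' q' (a j ω, b j ω) ∂μ = R s q s' q' := by
    intro q q'
    simp only [← Complex.ofReal_mul]
    rw [integral_complex_ofReal, hR s q s' q' μ a b h j]
  have hexp : ∀ (α β p q p' q' : ℂ), (p + α * q) * (p' + β * q') =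
      p * p' + β * (p * q') + α * (q * p') + α * β * (q * q') := by
    intros
    ring
  simp only [inputValue_eq, hexp]
  rw [integral_add, integral_add, integral_add, integral_const_mul, integral_const_mul,
    integral_const_mul, hval, hval, hval, hval]
  · exact hint _ _
  · exact (hint _ _).const_mul _
  · exact (hint _ _).add ((hint _ _).const_mul _)
  · exact (hint _ _).const_mul _
  · exact ((hint _ _).add ((hint _ _).const_mul _)).add ((hint _ _).const_mul _)
  · exact (hint _ _).const_mul _

end Covariance

/-! ### Expectations of products of random inputs -/

section InputExpectation

variable {m L : ℕ} {Ω₀ : Type*} [MeasurableSpace Ω₀]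

/-- The expectation of the product of the random inputs `u l` read off on the sides `s l`, where
different copies are independent. -/
noncomputable def inputExpectation (μ₀ : Measure Ω₀) (a b : ℤ → Ω₀ → ℂ)
    (x : Fin L → MatrixLabel m × Bool) (u : Fin L → ℤ) (s : Fin L → Bool) : ℂ :=
  ∏ c : Fin m, ∫ ω, ∏ l with copyIndex (x l) = some c,
    inputValue (x l).2 (s l) (a (u l) ω, b (u l) ω) ∂μ₀

/-- The expectation of the product of the random inputs over a set of positions. -/
noncomputable def blockExpectation (μ₀ : Measure Ω₀) (a b : ℤ → Ω₀ → ℂ)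
    (x : Fin L → MatrixLabel m × Bool) (u : Fin L → ℤ) (s : Fin L → Bool) (T : Finset (Fin L)) : ℂ :=
  ∫ ω, ∏ l ∈ T, inputValue (x l).2 (s l) (a (u l) ω, b (u l) ω) ∂μ₀

variable {μ₀ : Measure Ω₀} {v : Fin 4 → ℝ} {ρ : Fin 6 → ℝ} {c : ℕ → ℝ}
  {a b : ℤ → Ω₀ → ℂ}

theorem norm_inputExpectation_le [IsProbabilityMeasure μ₀] (h : InputAssumption μ₀ v ρ c a b)
    (x : Fin L → MatrixLabel m × Bool) (u : Fin L → ℤ) (s : Fin L → Bool) :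
    ‖inputExpectation μ₀ a b x u s‖ ≤ momentBound c L ^ m := by
  rw [inputExpectation, norm_prod]
  calc _ ≤ ∏ _c : Fin m, momentBound c L := Finset.prod_le_prod (fun _ _ => norm_nonneg _)
        fun k _ => h.norm_integral_prod_le _ (fun l => (x l).2) s u
    _ = _ := by simp

theorem inputKey_eq_inl_iff {x : Fin L → MatrixLabel m × Bool} {u : Fin L → ℤ} {l : Fin L}
    {p : Fin m × ℤ} : inputKey x u l = .inl p ↔ copyIndex (x l) = some p.1 ∧ u l = p.2 := by
  rcases h : copyIndex (x l) with _ | k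
  · simp [inputKey_of_copyIndex_eq_none h]
  · simp [inputKey_of_copyIndex_eq_some h, Prod.ext_iff]

/-- Within one copy, pairs with different indices are independent, so the expectation splits along
the values of `u`. -/
theorem inputExpectation_eq_prod_keys (h : InputAssumption μ₀ v ρ c a b)
    (x : Fin L → MatrixLabel m × Bool) (u : Fin L → ℤ) (s : Fin L → Bool) :
    inputExpectation μ₀ a b x u s = ∏ p ∈ Finset.univ ×ˢ Finset.univ.image u,
      blockExpectation μ₀ a b x u s (Finset.univ.filter fun l => inputKey x u l = .inl p) := by
  rw [Finset.prod_product, inputExpectation]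
  refine Finset.prod_congr rfl fun k _ => ?_
  set J := Finset.univ.image u
  have hind : iIndepFun (fun (j : J) ω => (a j ω, b j ω)) μ₀ :=
    h.indep.precomp Subtype.val_injective
  have hfac := hind.integral_fun_prod_comp
    (f := fun (j : J) z => ∏ l with inputKey x u l = .inl (k, (j : ℤ)), inputValue (x l).2 (s l) z)
    (fun j => ((h.measurable_a j).prodMk (h.measurable_b j)).aemeasurable)
    (fun j => (Finset.measurable_fun_prod _ fun l _ =>
      measurable_inputValue _ _).aestronglyMeasurable)
  rw [← Finset.prod_coe_sort J]
  have hleft : ∀ ω, ∏ l with copyIndex (x l) = some k,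
      inputValue (x l).2 (s l) (a (u l) ω, b (u l) ω) =
      ∏ j : J, ∏ l with inputKey x u l = .inl (k, (j : ℤ)),
        inputValue (x l).2 (s l) (a j ω, b j ω) := by
    intro ω
    rw [← Finset.prod_fiberwise_of_maps_to (t := J) (g := u)
      fun l _ => Finset.mem_image_of_mem u (Finset.mem_univ l), ← Finset.prod_coe_sort J]
    refine Finset.prod_congr rfl fun j _ => ?_
    rw [Finset.filter_filter]
    refine Finset.prod_congr ?_ fun l hl => ?_
    · ext l
      simp [inputKey_eq_inl_iff]
    · rw [(inputKey_eq_inl_iff.1 (Finset.mem_filter.1 hl).2).2]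
  simp only [hleft, hfac, blockExpectation]
  refine Finset.prod_congr rfl fun j _ => ?_
  refine integral_congr_ae (.of_forall fun ω => Finset.prod_congr rfl fun l hl => ?_)
  rw [(inputKey_eq_inl_iff.1 (Finset.mem_filter.1 hl).2).2]

/-- The factor of a key that occurs once is the mean of a single centered input. -/
theorem inputExpectation_eq_zero (h : InputAssumption μ₀ v ρ c a b)
    (x : Fin L → MatrixLabel m × Bool) (u : Fin L → ℤ) (s : Fin L → Bool) (l : Fin L)
    (hl : copyIndex (x l) ≠ none) (hu : ∀ l', inputKey x u l = inputKey x u l' → l' = l) :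
    inputExpectation μ₀ a b x u s = 0 := by
  obtain ⟨k, hk⟩ := Option.ne_none_iff_exists'.1 hl
  rw [inputExpectation_eq_prod_keys h]
  refine Finset.prod_eq_zero (i := (k, u l)) (by simp) ?_
  have : (Finset.univ.filter fun l' => inputKey x u l' = .inl (k, u l)) = {l} := by
    ext l'
    simp only [Finset.mem_filter, Finset.mem_univ, true_and, Finset.mem_singleton]
    rw [← inputKey_of_copyIndex_eq_some hk u]
    exact ⟨fun h => hu l' h.symm, fun h => by rw [h]⟩
  rw [this, blockExpectation]
  simp only [Finset.prod_singleton]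
  exact h.integral_inputValue _ _ _

open Classical in
-- Keys that occur correspond to random blocks; a key that does not occur contributes the integral
-- of `1`, which is `1` for a probability measure.
theorem inputExpectation_eq_prod_blocks [IsProbabilityMeasure μ₀]
    (h : InputAssumption μ₀ v ρ c a b) (x : Fin L → MatrixLabel m × Bool) (u : Fin L → ℤ) (s : Fin L → Bool) (π : Setoid (Fin L))
    (hπ : Setoid.ker (inputKey x u) = π) :
    inputExpectation μ₀ a b x u s = ∏ β ∈ randomBlocks x π,
      blockExpectation μ₀ a b x u s (Finset.univ.filter fun l => Quotient.mk π l = β) := by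
  have hrel : ∀ l l', Quotient.mk π l = Quotient.mk π l' ↔ inputKey x u l = inputKey x u l' := by
    intro l l'
    rw [Quotient.eq, ← hπ]
    rfl
  rw [inputExpectation_eq_prod_keys h,
    ← Finset.prod_filter_of_ne (p := fun p => ∃ l, inputKey x u l = .inl p)]
  swap
  · intro p _ hp
    by_contra hcon
    push Not at hcon
    refine hp ?_
    rw [Finset.filter_eq_empty_iff.2 fun l _ => hcon l]
    simp [blockExpectation]
  have hch : ∀ p ∈ (Finset.univ ×ˢ Finset.univ.image u).filter
      fun p => ∃ l, inputKey x u l = .inl p, ∃ l, inputKey x u l = .inl p :=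
    fun p hp => (Finset.mem_filter.1 hp).2
  refine Finset.prod_bij (fun p hp => Quotient.mk π (hch p hp).choose) (fun p hp => ?_)
    (fun p hp p' hp' heq => ?_) (fun β hβ => ?_) (fun p hp => ?_)
  · rw [mk_mem_randomBlocks ⟨u, hπ⟩, (inputKey_eq_inl_iff.1 (hch p hp).choose_spec).1]
    simp
  · rw [hrel, (hch p hp).choose_spec, (hch p' hp').choose_spec] at heq
    exact Sum.inl_injective heq
  · obtain ⟨l, hl, rfl⟩ := Finset.mem_image.1 hβ
    obtain ⟨k, hk⟩ := Option.ne_none_iff_exists'.1 (mem_randomPositions.1 hl)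
    have hkey := inputKey_of_copyIndex_eq_some hk u
    have hmem : (k, u l) ∈ (Finset.univ ×ˢ Finset.univ.image u).filter
        fun p => ∃ l, inputKey x u l = .inl p := by
      rw [Finset.mem_filter]
      exact ⟨by simp, l, hkey⟩
    refine ⟨_, hmem, ?_⟩
    rw [hrel, (hch _ hmem).choose_spec, hkey]
  · congr 1
    ext l
    simp only [Finset.mem_filter, Finset.mem_univ, true_and, hrel, (hch p hp).choose_spec]

/-- If every random input occurs exactly twice, the expectation depends only on the sides. -/
theorem exists_inputExpectation_eq_of_isPairing (v : Fin 4 → ℝ) (ρ : Fin 6 → ℝ) (c : ℕ → ℝ)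
    (x : Fin L → MatrixLabel m × Bool) (π : Setoid (Fin L)) (hpair : IsPairing x π) :
    ∃ ψ : (Fin L → Bool) → ℂ, ∀ {Ω₀ : Type*} [MeasurableSpace Ω₀] (μ₀ : Measure Ω₀)
      [IsProbabilityMeasure μ₀] (a b : ℤ → Ω₀ → ℂ), InputAssumption μ₀ v ρ c a b → ∀ u s,
        Setoid.ker (inputKey x u) = π → inputExpectation μ₀ a b x u s = ψ s := by
  classical
  choose R hR using exists_integral_inputValue_mul v ρ c
  -- The partner becomes a total function; its value at deterministic positions is never used.
  have hpair' : ∀ l, ∃ l', copyIndex (x l) ≠ none → l' ≠ l ∧ ∀ k, π l k ↔ k = l ∨ k = l' := by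
    intro l
    by_cases hl : copyIndex (x l) ≠ none
    · obtain ⟨l', hl'⟩ := hpair l hl
      exact ⟨l', fun _ => hl'⟩
    · exact ⟨l, fun h => absurd h hl⟩
  choose partner hpartner using hpair'
  refine ⟨fun s => ∏ β ∈ randomBlocks x π, R (x β.out).2 (s β.out) (x (partner β.out)).2
    (s (partner β.out)), ?_⟩
  intro Ω₀ _ μ₀ _ a b h u s hπ
  rw [inputExpectation_eq_prod_blocks h x u s π hπ]
  refine Finset.prod_congr rfl fun β hβ => ?_
  have hl : copyIndex (x β.out) ≠ none := by
    rwa [← mk_mem_randomBlocks ⟨u, hπ⟩, β.out_eq]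
  obtain ⟨hne, hk⟩ := hpartner β.out hl
  have hfilter : (Finset.univ.filter fun l => Quotient.mk π l = β) =
      {β.out, partner β.out} := by
    ext l
    simp only [Finset.mem_filter, Finset.mem_univ, true_and, Finset.mem_insert,
      Finset.mem_singleton, ← hk]
    rw [Quotient.mk_eq_iff_out]
    exact ⟨fun h => π.symm h, fun h => π.symm h⟩
  have hu : u (partner β.out) = u β.out := by
    have hrel : ∀ l l', π l l' → u l = u l' := by
      intro l l' h
      rw [← hπ] at h
      exact eq_of_inputKey_eq h
    exact (hrel _ _ ((hk _).2 (Or.inr rfl))).symm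
  rw [hfilter, blockExpectation]
  simp only [Finset.prod_pair hne.symm, hu]
  exact hR _ _ _ _ μ₀ a b h _

end InputExpectation

/-! ### Mixed moments of the matrices -/

section MixedMoments

variable {m L : ℕ}

/-- The entry that a deterministic letter reads off at the input `k`; `1` for random letters. -/
noncomputable def deterministicWeight (d' d'' : Fin m → ℤ → ℂ) (x : MatrixLabel m × Bool) (s : Bool)
    (k : ℤ) : ℂ :=
  match x.1 with
  | .perm => if k = 0 then 1 else 0
  | .rand _ => 1
  | .det i => inputValue x.2 s (d' i k, d'' i k)

/-- A summable bound for the entries of the deterministic letters. -/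
noncomputable def deterministicBound (d' d'' : Fin m → ℤ → ℂ) (x : MatrixLabel m × Bool) (k : ℤ) :
    ℝ :=
  match x.1 with
  | .perm => if k = 0 then 1 else 0
  | .rand _ => 0
  | .det i => ‖d' i k‖ + ‖d'' i k‖

theorem deterministicBound_nonneg (d' d'' : Fin m → ℤ → ℂ) (x : MatrixLabel m × Bool) (k : ℤ) :
    0 ≤ deterministicBound d' d'' x k := by
  unfold deterministicBound
  split
  · split <;> simp
  · exact le_rfl
  · positivity

theorem summable_deterministicBound {d' d'' : Fin m → ℤ → ℂ}
    (hd' : ∀ i, Summable fun k => ‖d' i k‖) (hd'' : ∀ i, Summable fun k => ‖d'' i k‖)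
    (x : MatrixLabel m × Bool) : Summable (deterministicBound d' d'' x) := by
  obtain ⟨_ | _ | i, _⟩ := x
  · exact summable_of_ne_finset_zero (s := {0}) fun k hk => if_neg (by simpa using hk)
  · exact summable_zero
  · exact (hd' i).add (hd'' i)

theorem norm_deterministicWeight_le (d' d'' : Fin m → ℤ → ℂ) (x : MatrixLabel m × Bool) (s : Bool)
    (k : ℤ) (hx : copyIndex x = none) :
    ‖deterministicWeight d' d'' x s k‖ ≤ deterministicBound d' d'' x k := by
  obtain ⟨_ | _ | i, ε⟩ := x
  · simp only [deterministicWeight, deterministicBound]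
    split <;> simp
  · simp [copyIndex] at hx
  · simp only [deterministicWeight, deterministicBound, norm_inputValue]
    cases s <;> simp

theorem deterministicWeight_eq_one (d' d'' : Fin m → ℤ → ℂ) (x : MatrixLabel m × Bool) (s : Bool)
    (k : ℤ) (hx : copyIndex x ≠ none) : deterministicWeight d' d'' x s k = 1 := by
  obtain ⟨_ | _ | i, ε⟩ := x <;> simp_all [copyIndex, deterministicWeight]

/-- The entry of a matrix or of its adjoint. -/
noncomputable def starEntry {n : ℕ} (ε : Bool) (p q : Fin n) (A : Fin n → Fin n → ℂ) : ℂ :=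
  if ε then star (A q p) else A p q

theorem measurable_starEntry {n : ℕ} (ε : Bool) (p q : Fin n) :
    Measurable (starEntry ε p q) := by
  unfold starEntry
  cases ε
  · simp only [Bool.false_eq_true, if_false]
    fun_prop
  · simp only [if_true]
    fun_prop

/-- The side condition is symmetric in row and column, so taking the adjoint conjugates the entry
and reverses the sign of the index but keeps the side. -/
theorem starEntry_genToeplitz {n : ℕ} (x : MatrixLabel m × Bool) (hx : x.1 ≠ .perm) (s t : ℤ → ℂ)
    (p q : Fin n) : starEntry x.2 p q (genToeplitz n s t) =
      inputValue x.2 (decide ((p : ℤ) + q + 2 ≤ n))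
        (s (stepIndex n x p q), t (stepIndex n x p q)) := by
  have h1 : ((p : ℕ) + 1 + (q + 1) ≤ n) ↔ ((p : ℤ) + q + 2 ≤ n) := by omega
  have h2 : ((q : ℕ) + 1 + (p + 1) ≤ n) ↔ ((p : ℤ) + q + 2 ≤ n) := by omega
  obtain ⟨_ | _ | _, _ | _⟩ := x <;>
    simp_all [starEntry, inputValue, genToeplitz, stepIndex]

theorem starEntry_scaledToeplitz {Ω₀ : Type*} {n : ℕ} (x : MatrixLabel m × Bool) (hx : x.1 ≠ .perm)
    (a b : ℤ → Ω₀ → ℂ) (ω : Ω₀) (p q : Fin n) :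
    starEntry x.2 p q (scaledToeplitz n a b ω) = (((√n)⁻¹ : ℝ) : ℂ) *
      inputValue x.2 (decide ((p : ℤ) + q + 2 ≤ n))
        (a (stepIndex n x p q) ω, b (stepIndex n x p q) ω) := by
  rw [← starEntry_genToeplitz x hx (fun j => a j ω) (fun j => b j ω) p q, scaledToeplitz]
  cases x.2 <;> simp [starEntry]

theorem starEntry_backwardIdentity {n : ℕ} (ε : Bool) (p q : Fin n) :
    starEntry ε p q (backwardIdentity n) = if (n : ℤ) - 1 - p - q = 0 then 1 else 0 := by
  have h1 : q = p.rev ↔ (n : ℤ) - 1 - p - q = 0 := by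
    rw [Fin.ext_iff, Fin.val_rev]
    omega
  have h2 : p = q.rev ↔ (n : ℤ) - 1 - p - q = 0 := by
    rw [Fin.ext_iff, Fin.val_rev]
    omega
  cases ε <;> simp [starEntry, backwardIdentity, h1, h2]

theorem starEntry_matrixFamily {Ω : ℕ → Type*} (B : Fin m → ∀ n, Ω n → Matrix (Fin n) (Fin n) ℂ)
    (d' d'' : Fin m → ℤ → ℂ) (n : ℕ) (ω : Ω n) (x : MatrixLabel m × Bool) (p q : Fin n) :
    starEntry x.2 p q (matrixFamily B d' d'' x.1 n ω) =
      deterministicWeight d' d'' x (decide ((p : ℤ) + q + 2 ≤ n)) (stepIndex n x p q) *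
        (copyIndex x).elim 1 fun k => starEntry x.2 p q (B k n ω) := by
  obtain ⟨_ | k | i, ε⟩ := x
  · simp only [matrixFamily, deterministicWeight, copyIndex, stepIndex, starEntry_backwardIdentity,
      Option.elim_none, mul_one]
    rfl
  · simp [matrixFamily, deterministicWeight, copyIndex]
  · have h := starEntry_genToeplitz (n := n) (⟨.det i, ε⟩ : MatrixLabel m × Bool) (by simp)
      (d' i) (d'' i) p q
    simpa [matrixFamily, deterministicWeight, copyIndex] using h

theorem measurable_scaledToeplitz {Ω₀ : Type*} [MeasurableSpace Ω₀] {a b : ℤ → Ω₀ → ℂ}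
    (ha : ∀ j, Measurable (a j)) (hb : ∀ j, Measurable (b j)) (n : ℕ) :
    Measurable fun ω (r s : Fin n) => scaledToeplitz n a b ω r s := by
  refine measurable_pi_lambda _ fun r => measurable_pi_lambda _ fun s => ?_
  simp only [scaledToeplitz, genToeplitz, Matrix.smul_apply, Matrix.of_apply, smul_eq_mul]
  split
  · exact (ha _).const_mul _
  · exact (hb _).const_mul _

theorem hasAllMoments_scaledToeplitz {Ω₀ : Type*} [MeasurableSpace Ω₀] {μ₀ : Measure Ω₀}
    [IsProbabilityMeasure μ₀] {v : Fin 4 → ℝ} {ρ : Fin 6 → ℝ} {c : ℕ → ℝ} {a b : ℤ → Ω₀ → ℂ}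
    (h : InputAssumption μ₀ v ρ c a b) {n : ℕ} (r s : Fin n) :
    HasAllMoments μ₀ fun ω => scaledToeplitz n a b ω r s := by
  simp only [scaledToeplitz, genToeplitz, Matrix.smul_apply, Matrix.of_apply, smul_eq_mul]
  split
  · exact (HasAllMoments.const _).mul (h.hasAllMoments_a _)
  · exact (HasAllMoments.const _).mul (h.hasAllMoments_b _)

theorem IsIndepCopies.hasAllMoments {ι Ω Ω₀ : Type*} [MeasurableSpace Ω] [MeasurableSpace Ω₀]
    {μ : Measure Ω} {μ₀ : Measure Ω₀} {n : ℕ} {C : ι → Ω → Matrix (Fin n) (Fin n) ℂ}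
    {M : Ω₀ → Matrix (Fin n) (Fin n) ℂ} (h : IsIndepCopies μ μ₀ C M) {r s : Fin n}
    (hM : HasAllMoments μ₀ fun ω => M ω r s) (i : ι) : HasAllMoments μ fun ω => C i ω r s := by
  have hid := (h.ident i).comp (u := fun A : Fin n → Fin n → ℂ => A r s) (by fun_prop)
  exact fun k => hid.memLp_iff.2 (hM k)

theorem prod_copyIndex_elim (x : Fin L → MatrixLabel m × Bool) (f : Fin L → Fin m → ℂ) :
    (∏ l, (copyIndex (x l)).elim 1 (f l)) = ∏ k, ∏ l with copyIndex (x l) = some k, f l k := by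
  rw [← Finset.prod_fiberwise Finset.univ fun l => copyIndex (x l), Fintype.prod_option]
  rw [Finset.prod_eq_one, one_mul]
  · refine Finset.prod_congr rfl fun k _ => Finset.prod_congr rfl fun l hl => ?_
    rw [(Finset.mem_filter.1 hl).2, Option.elim_some]
  · intro l hl
    rw [(Finset.mem_filter.1 hl).2, Option.elim_none]

theorem sum_card_copyIndex (x : Fin L → MatrixLabel m × Bool) :
    ∑ k, (Finset.univ.filter fun l => copyIndex (x l) = some k).card =
      (randomPositions x).card := by
  rw [Finset.card_eq_sum_card_fiberwise (f := fun l => copyIndex (x l))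
    (t := Finset.univ.image some)]
  · rw [Finset.sum_image fun _ _ _ _ h => Option.some_injective _ h]
    refine Finset.sum_congr rfl fun k _ => ?_
    congr 1
    ext l
    simp only [Finset.mem_filter, Finset.mem_univ, true_and, mem_randomPositions]
    exact ⟨fun h => ⟨by simp [h], h⟩, fun h => h.2⟩
  · intro l hl
    obtain ⟨k, hk⟩ := Option.ne_none_iff_exists'.1 (mem_randomPositions.1 hl)
    simp [hk]

/-- The expectation of the product of the entries along a path. -/
theorem integral_prod_starEntry {Ω : ℕ → Type*} {n : ℕ} [MeasurableSpace (Ω n)]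
    {μ : Measure (Ω n)} {Ω₀ : Type*} [MeasurableSpace Ω₀] {μ₀ : Measure Ω₀}
    {a b : ℤ → Ω₀ → ℂ} (B : Fin m → ∀ n, Ω n → Matrix (Fin n) (Fin n) ℂ)
    (hB : IsIndepCopies μ μ₀ (fun i => B i n) (scaledToeplitz n a b)) (d' d'' : Fin m → ℤ → ℂ)
    (x : Fin L → MatrixLabel m × Bool) (p : Fin (L + 1) → Fin n) :
    ∫ ω, ∏ l, starEntry (x l).2 (p l.castSucc) (p l.succ) (matrixFamily B d' d'' (x l).1 n ω) ∂μ =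
      (((√n)⁻¹ : ℝ) : ℂ) ^ (randomPositions x).card *
      ((∏ l, deterministicWeight d' d'' (x l)
          (decide ((p l.castSucc : ℤ) + (p l.succ : ℤ) + 2 ≤ n))
          (stepIndex n (x l) (p l.castSucc) (p l.succ))) *
        inputExpectation μ₀ a b x (fun l => stepIndex n (x l) (p l.castSucc) (p l.succ))
          fun l => decide ((p l.castSucc : ℤ) + (p l.succ : ℤ) + 2 ≤ n)) := by
  simp only [starEntry_matrixFamily, Finset.prod_mul_distrib, prod_copyIndex_elim]
  rw [integral_const_mul, mul_left_comm]
  congr 1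
  let f : Fin m → (Fin n → Fin n → ℂ) → ℂ := fun k A => ∏ l with copyIndex (x l) = some k,
    starEntry (x l).2 (p l.castSucc) (p l.succ) A
  have hf : ∀ k, Measurable (f k) := fun k =>
    Finset.measurable_fun_prod _ fun l _ => measurable_starEntry _ _ _
  -- Independence factors the expectation over the copies; equality in law then moves each factor to
  -- `μ₀`. Every random letter leaves one factor `n^{-1/2}`.
  have hfac := hB.indep.integral_fun_prod_comp (f := f) (fun k => (hB.ident k).aemeasurable_fst)
    (fun k => (hf k).aestronglyMeasurable)
  refine hfac.trans ?_
  rw [← sum_card_copyIndex, ← Finset.prod_pow_eq_pow_sum, inputExpectation,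
    ← Finset.prod_mul_distrib]
  refine Finset.prod_congr rfl fun k _ => ?_
  refine ((hB.ident k).comp (hf k)).integral_eq.trans ?_
  rw [← integral_const_mul]
  refine integral_congr_ae (.of_forall fun ω => ?_)
  simp only [Function.comp, f]
  rw [← Finset.prod_const, ← Finset.prod_mul_distrib]
  refine Finset.prod_congr rfl fun l hl => ?_
  refine starEntry_scaledToeplitz (x l) (fun hperm => ?_) a b ω _ _
  have := (Finset.mem_filter.1 hl).2
  simp [copyIndex, hperm] at this

theorem hasAllMoments_matrixFamily {Ω : ℕ → Type*} [∀ n, MeasurableSpace (Ω n)]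
    {μ : ∀ n, Measure (Ω n)} [∀ n, IsFiniteMeasure (μ n)]
    {B : Fin m → ∀ n, Ω n → Matrix (Fin n) (Fin n) ℂ} (d' d'' : Fin m → ℤ → ℂ)
    (hB : ∀ i n r s, HasAllMoments (μ n) fun ω => B i n ω r s) (x : MatrixLabel m) (n : ℕ)
    (r s : Fin n) : HasAllMoments (μ n) fun ω => matrixFamily B d' d'' x n ω r s := by
  cases x with
  | perm => exact .const _
  | rand i => exact hB i n r s
  | det i => exact .const _

theorem traceState_starMonomial_eq {Ω : ℕ → Type*} [∀ n, MeasurableSpace (Ω n)]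
    {μ : ∀ n, Measure (Ω n)} [∀ n, IsProbabilityMeasure (μ n)] {Ω₀ : ℕ → Type*}
    [∀ n, MeasurableSpace (Ω₀ n)] {μ₀ : ∀ n, Measure (Ω₀ n)}
    {a b : ∀ n, ℤ → Ω₀ n → ℂ} {B : Fin m → ∀ n, Ω n → Matrix (Fin n) (Fin n) ℂ}
    (hmom : ∀ i n r s, HasAllMoments (μ n) fun ω => B i n ω r s) {n : ℕ}
    (hB : IsIndepCopies (μ n) (μ₀ n) (fun i => B i n) (scaledToeplitz n (a n) (b n)))
    (d' d'' : Fin m → ℤ → ℂ) (x : Fin L → MatrixLabel m × Bool) :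
    (traceState (μ n) fun ω => starMonomial (fun i => matrixFamily B d' d'' i n ω) (List.ofFn x)) =
      (n : ℂ)⁻¹ * (((√n)⁻¹ : ℝ) : ℂ) ^ (randomPositions x).card *
        ∑ y ∈ latticeBox (Option (Fin L)) n,
          pathWeight x (fun l => deterministicWeight d' d'' (x l))
            (fun n => inputExpectation (μ₀ n) (a n) (b n) x) n y := by
  classical
  have htrace : ∀ ω, (starMonomial (fun i => matrixFamily B d' d'' i n ω) (List.ofFn x)).trace =
      ∑ p : Fin (L + 1) → Fin n, if p 0 = p (Fin.last L) then
        ∏ l, starEntry (x l).2 (p l.castSucc) (p l.succ) (matrixFamily B d' d'' (x l).1 n ω)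
      else 0 := by
    intro ω
    rw [starMonomial, List.map_ofFn, Matrix.trace_list_ofFn_prod]
    refine Finset.sum_congr rfl fun p _ => ?_
    split
    · refine Finset.prod_congr rfl fun l _ => ?_
      simp only [Function.comp, starEntry]
      split <;> simp
    · rfl
  have hentry : ∀ (l : Fin L) (p q : Fin n), HasAllMoments (μ n) fun ω =>
      starEntry (x l).2 p q (matrixFamily B d' d'' (x l).1 n ω) := by
    intro l p q
    unfold starEntry
    split
    · exact (hasAllMoments_matrixFamily d' d'' hmom _ _ _ _).star
    · exact hasAllMoments_matrixFamily d' d'' hmom _ _ _ _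
  simp only [traceState, htrace]
  rw [integral_finsetSum, mul_assoc]
  swap
  · intro p _
    split
    · exact (HasAllMoments.prod _ fun l _ => hentry l _ _).integrable
    · exact integrable_zero _ _ _
  congr 1
  -- The summand is extended to integer paths, so that the change to step coordinates applies.
  let H : (Fin (L + 1) → ℤ) → ℂ := fun q => if q 0 = q (Fin.last L) then
    (∏ l : Fin L, deterministicWeight d' d'' (x l) (decide (q l.castSucc + q l.succ + 2 ≤ n))
      (stepIndex n (x l) (q l.castSucc) (q l.succ))) *
    inputExpectation (μ₀ n) (a n) (b n) x
      (fun l => stepIndex n (x l) (q l.castSucc) (q l.succ))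
      (fun l => decide (q l.castSucc + q l.succ + 2 ≤ n)) else 0
  trans (((√n)⁻¹ : ℝ) : ℂ) ^ (randomPositions x).card *
    ∑ p : Fin (L + 1) → Fin n, H fun l => p l
  · rw [Finset.mul_sum]
    refine Finset.sum_congr rfl fun p _ => ?_
    have hiff : p 0 = p (Fin.last L) ↔ ((p 0 : ℕ) : ℤ) = (p (Fin.last L) : ℕ) := by
      rw [Fin.ext_iff, Nat.cast_inj]
    simp only [H, hiff]
    split
    · exact integral_prod_starEntry B hB d' d'' x p
    · simp
  · rw [sum_paths_eq_sum_latticeBox n x H]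
    congr 1
    refine Finset.sum_congr rfl fun y _ => ?_
    have hstep : ∀ l : Fin L, stepIndex n (x l) (latticePath n x y l)
        (latticePath n x y (l + 1)) = y (some l) := fun l => by
      rw [latticePath_succ, stepIndex_nextPosition]
    simp only [H, pathWeight, pathSide, Fin.val_zero, Fin.val_last, Fin.val_castSucc, Fin.val_succ,
      hstep, ite_and]
    rfl

end MixedMoments

/-! ### Joint convergence -/

theorem convergeJointly_matrixFamily {m : ℕ} {Ω₀ : ℕ → Type*} [∀ n, MeasurableSpace (Ω₀ n)]
    (μ₀ : ∀ n, Measure (Ω₀ n)) [∀ n, IsProbabilityMeasure (μ₀ n)]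
    {Ω : ℕ → Type*} [∀ n, MeasurableSpace (Ω n)]
    (μ : ∀ n, Measure (Ω n)) [∀ n, IsProbabilityMeasure (μ n)]
    (v : Fin 4 → ℝ) (ρ : Fin 6 → ℝ) (c : ℕ → ℝ) (a b : ∀ n, ℤ → Ω₀ n → ℂ)
    (hab : ∀ n, 1 ≤ n → InputAssumption (μ₀ n) v ρ c (a n) (b n))
    (d' d'' : Fin m → ℤ → ℂ)
    (hd' : ∀ i, Summable fun k => ‖d' i k‖) (hd'' : ∀ i, Summable fun k => ‖d'' i k‖)
    (B : Fin m → ∀ n, Ω n → Matrix (Fin n) (Fin n) ℂ)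
    (hB : ∀ n, 1 ≤ n →
      IsIndepCopies (μ n) (μ₀ n) (fun i => B i n) (scaledToeplitz n (a n) (b n))) :
    ConvergeJointly μ (matrixFamily B d' d'') := by
  have hmom : ∀ i n r s, HasAllMoments (μ n) fun ω => B i n ω r s := fun i n r s =>
    -- An entry exists only for `n ≥ 1`, which is where the assumptions hold.
    (hB n r.pos).hasAllMoments (hasAllMoments_scaledToeplitz (hab n r.pos) r s) i
  refine convergeJointly_of_forall_tendsto μ _ (hasAllMoments_matrixFamily d' d'' hmom)
    fun w _ => ?_
  obtain ⟨r, hr⟩ := exists_tendsto_sum_pathWeight w.get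
    (fun l => deterministicWeight d' d'' (w.get l)) (fun l => deterministicBound d' d'' (w.get l))
    (fun n => inputExpectation (μ₀ n) (a n) (b n) w.get) (momentBound c w.length ^ m)
    (fun l => summable_deterministicBound hd' hd'' _) (fun l => deterministicBound_nonneg d' d'' _)
    (fun l => norm_deterministicWeight_le d' d'' _)
    (fun l => deterministicWeight_eq_one d' d'' _)
    (fun n hn => norm_inputExpectation_le (hab n hn) _)
    (fun n hn => inputExpectation_eq_zero (hab n hn) _)
    (fun π hπ => by
      obtain ⟨ψ, hψ⟩ := exists_inputExpectation_eq_of_isPairing v ρ c w.get π hπ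
      exact ⟨ψ, fun n hn => hψ (μ₀ n) (a n) (b n) (hab n hn)⟩)
  refine ⟨r, hr.congr' ?_⟩
  filter_upwards [eventually_ge_atTop 1] with n hn
  have h := traceState_starMonomial_eq hmom (hB n hn) d' d'' w.get
  rw [List.ofFn_get] at h
  exact h.symm

/-- Joint convergence is inherited by monomials in the matrices. -/
theorem ConvergeJointly.starMonomial {ι κ : Type*} {Ω : ℕ → Type*} [∀ n, MeasurableSpace (Ω n)]
    {μ : ∀ n, Measure (Ω n)} [∀ n, IsFiniteMeasure (μ n)]
    {M : ι → ∀ n, Ω n → Matrix (Fin n) (Fin n) ℂ} (h : ConvergeJointly μ M)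
    (σ : κ → List (ι × Bool)) (hσ : ∀ k, σ k ≠ []) :
    ConvergeJointly μ fun k n ω => starMonomial (fun i => M i n ω) (σ k) := by
  obtain ⟨A, _, _, _, _, φ, x, hmem, hlim⟩ := h
  -- A starred letter is replaced by the adjoint word, so a word in the monomials is a word in the
  -- original letters. It stays nonempty, as the hypothesis on limits requires.
  let τ : κ × Bool → List (ι × Bool) := fun l =>
    if l.2 then (adjointWord (FreeMonoid.ofList (σ l.1))).toList else σ l.1
  have hτ : ∀ l, τ l ≠ [] := by
    rintro ⟨k, _ | _⟩
    · exact hσ k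
    · simpa [τ, adjointWord] using hσ k
  have hsub : ∀ {R : Type} [Ring R] [StarRing R] (y : ι → R) (w : List (κ × Bool)),
      _root_.starMonomial (fun k => _root_.starMonomial y (σ k)) w =
        _root_.starMonomial y (w.flatMap τ) := by
    intro R _ _ y w
    induction w with
    | nil => rfl
    | cons l w ih =>
      rw [List.flatMap_cons]
      simp only [_root_.starMonomial, List.map_cons, List.prod_cons, List.map_append,
        List.prod_append] at ih ⊢
      rw [ih]
      congr 1
      obtain ⟨k, _ | _⟩ := l
      · rfl
      · exact FreeStarAlgebra.star_starMonomial y (FreeMonoid.ofList (σ k))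
  refine ⟨A, _, _, _, ‹_›, φ, fun k => _root_.starMonomial x (σ k), fun k n r s j => ?_,
    fun w hw => ?_⟩
  · exact hasAllMoments_starMonomial (fun i r s => hmem i n r s) (σ k) r s j
  · have hw' : w.flatMap τ ≠ [] := by
      obtain ⟨l, w, rfl⟩ := List.exists_cons_of_ne_nil hw
      simp [hτ l]
    have := hlim _ hw'
    rw [hsub]
    refine this.congr fun n => ?_
    simp only [hsub]

/-! ### Reduction of Hankel to Toeplitz matrices -/

theorem backwardIdentity_mul_apply {n : ℕ} (M : Matrix (Fin n) (Fin n) ℂ) (i j : Fin n) :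
    (backwardIdentity n * M) i j = M i.rev j := by
  simp [backwardIdentity, Matrix.mul_apply]

theorem backwardIdentity_mul_self (n : ℕ) : backwardIdentity n * backwardIdentity n = 1 := by
  ext i j
  rw [backwardIdentity_mul_apply, backwardIdentity, Matrix.of_apply, Fin.rev_rev, Matrix.one_apply]
  simp [eq_comm]

theorem asymHankel_eq (n : ℕ) (s t : ℤ → ℂ) :
    asymHankel n s t = backwardIdentity n * genToeplitz n s t := by
  ext i j
  have hi := i.2
  have hj := j.2
  rw [backwardIdentity_mul_apply, asymHankel, genToeplitz, Matrix.of_apply, Matrix.of_apply,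
    Fin.val_rev]
  -- Reversing the rows carries the strict lower triangle to the region `i + j ≤ n` (numbered from
  -- `1`).
  have h1 : j < i ↔ n - (i + 1) + 1 + (j + 1) ≤ n := by
    rw [Fin.lt_def]
    omega
  have h2 : (n : ℤ) + 1 - (i + 1) - (j + 1) = ((n - (i + 1) : ℕ) : ℤ) - j := by omega
  simp only [h1, h2]

theorem scaledHankel_apply_rev {Ω : Type*} (n : ℕ) (a b : ℤ → Ω → ℂ) (ω : Ω) (i j : Fin n) :
    scaledHankel n a b ω i.rev j = scaledToeplitz n a b ω i j := by
  simp only [scaledHankel, scaledToeplitz, Matrix.smul_apply, asymHankel_eq,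
    backwardIdentity_mul_apply, Fin.rev_rev]

/-- Reversing the rows of independent copies of the Hankel matrix yields independent copies of the
Toeplitz matrix. -/
theorem IsIndepCopies.backwardIdentity_mul {ι Ω Ω₀ : Type*} [MeasurableSpace Ω]
    [MeasurableSpace Ω₀] {μ : Measure Ω} {μ₀ : Measure Ω₀} {n : ℕ} {a b : ℤ → Ω₀ → ℂ}
    {C : ι → Ω → Matrix (Fin n) (Fin n) ℂ} (h : IsIndepCopies μ μ₀ C (scaledHankel n a b)) :
    IsIndepCopies μ μ₀ (fun i ω => backwardIdentity n * C i ω) (scaledToeplitz n a b) := by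
  have hmeas : Measurable fun (A : Fin n → Fin n → ℂ) (r s : Fin n) => A r.rev s := by fun_prop
  constructor
  · intro i
    simp only [backwardIdentity_mul_apply, ← scaledHankel_apply_rev]
    exact (h.ident i).comp hmeas
  · simp only [backwardIdentity_mul_apply]
    exact h.indep.comp (fun _ (A : Fin n → Fin n → ℂ) (r s : Fin n) => A r.rev s) fun _ => hmeas

/-- The monomials that express `P_n`, `P_n B` and `D` in terms of `P_n`, `B` and `D`. -/
def hankelWord {m : ℕ} : MatrixLabel m → List (MatrixLabel m × Bool)
  | .perm => [(.perm, false)]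
  | .rand i => [(.perm, false), (.rand i, false)]
  | .det i => [(.det i, false)]

theorem starMonomial_hankelWord {m : ℕ} {Ω : ℕ → Type*}
    (C : Fin m → ∀ n, Ω n → Matrix (Fin n) (Fin n) ℂ) (d' d'' : Fin m → ℤ → ℂ) (k : MatrixLabel m)
    (n : ℕ) (ω : Ω n) :
    starMonomial (fun i => matrixFamily (fun i n ω => backwardIdentity n * C i n ω) d' d'' i n ω)
      (hankelWord k) = matrixFamily C d' d'' k n ω := by
  cases k with
  | perm => simp [starMonomial, hankelWord, matrixFamily]
  | rand i =>
    simp [starMonomial, hankelWord, matrixFamily, ← mul_assoc, backwardIdentity_mul_self]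
  | det i => simp [starMonomial, hankelWord, matrixFamily]

theorem theorem2p2 (m : ℕ)
    -- the space of the input sequences, and the space of the independent copies, for each size
    {Ω₀ : ℕ → Type*} [∀ n, MeasurableSpace (Ω₀ n)]
    (μ₀ : ∀ n, Measure (Ω₀ n)) [∀ n, IsProbabilityMeasure (μ₀ n)]
    {Ω : ℕ → Type*} [∀ n, MeasurableSpace (Ω n)]
    (μ : ∀ n, Measure (Ω n)) [∀ n, IsProbabilityMeasure (μ n)]
    (v : Fin 4 → ℝ) (ρ : Fin 6 → ℝ) (c : ℕ → ℝ)
    (a b : ∀ n, ℤ → Ω₀ n → ℂ)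
    (hab : ∀ n, 1 ≤ n → InputAssumption (μ₀ n) v ρ c (a n) (b n))
    (d' d'' : Fin m → ℤ → ℂ)
    (hd' : ∀ i, Summable fun k => ‖d' i k‖) (hd'' : ∀ i, Summable fun k => ‖d'' i k‖) :
    -- `P_n`, independent copies of `n^{-1/2} T_{n,g}`, and the `D_{n,g}^{(i)}`
    (∀ B : Fin m → ∀ n, Ω n → Matrix (Fin n) (Fin n) ℂ,
      (∀ n, 1 ≤ n →
        IsIndepCopies (μ n) (μ₀ n) (fun i => B i n) (scaledToeplitz n (a n) (b n))) →
      ConvergeJointly μ (matrixFamily B d' d'')) ∧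
    -- in particular, `P_n`, `n^{-1/2} T_{n,g}` and a single `D_{n,g}`
    (∀ e' e'' : ℤ → ℂ, (Summable fun k => ‖e' k‖) → (Summable fun k => ‖e'' k‖) →
      ConvergeJointly μ₀ (matrixFamily (m := 1) (fun _ n => scaledToeplitz n (a n) (b n))
        (fun _ => e') (fun _ => e''))) ∧
    -- asymmetric Hankel matrices: `H_n = P_n T_{n,g}`, and `P_n`, independent copies of
    -- `n^{-1/2} H_n`, and the `D_{n,g}^{(i)}`
    (∀ (n : ℕ) (s t : ℤ → ℂ), asymHankel n s t = backwardIdentity n * genToeplitz n s t) ∧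
    (∀ C : Fin m → ∀ n, Ω n → Matrix (Fin n) (Fin n) ℂ,
      (∀ n, 1 ≤ n →
        IsIndepCopies (μ n) (μ₀ n) (fun i => C i n) (scaledHankel n (a n) (b n))) →
      ConvergeJointly μ (matrixFamily C d' d'')) := by
  refine ⟨fun B hB => convergeJointly_matrixFamily μ₀ μ v ρ c a b hab d' d'' hd' hd'' B hB,
    fun e' e'' he' he'' => ?_, asymHankel_eq, fun C hC => ?_⟩
  · refine convergeJointly_matrixFamily μ₀ μ₀ v ρ c a b hab _ _ (fun _ => he') (fun _ => he'') _
      -- The matrix is a copy of itself, and a family with a single member is independent.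
      fun n hn => ⟨fun _ => .refl ?_, .of_subsingleton⟩
    exact (measurable_scaledToeplitz (hab n hn).measurable_a (hab n hn).measurable_b n).aemeasurable
  · have h := (convergeJointly_matrixFamily μ₀ μ v ρ c a b hab d' d'' hd' hd''
      (fun i n ω => backwardIdentity n * C i n ω)
      fun n hn => (hC n hn).backwardIdentity_mul).starMonomial hankelWord
        (fun k => by cases k <;> simp [hankelWord])
    simpa only [starMonomial_hankelWord] using h
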